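/- All graphs are finite and simple. For a graph $G$ let $N_k(G)$ be the number of (unlabeled) copies of $K_k$ in $G$, let $\delta(G)$ be its minimum degree, and for integers $k\ge 2$ and $0\le x\le n$ put $h_k(n,x)=\binom{n-x}{k}+x\binom{x}{k-1}$. "$G$ is a subgraph of $H$" means that $G$ is isomorphic to a subgraph of $H$. Define the following $n$-vertex graphs. - $H_{n,d}$: a clique $A$ on $n-d$ vertices and an independent set of $d$ further vertices, each adjacent to exactly the same $d$ vertices of $A$. - $K'_{n,d}$: the edge-disjoint union of $K_{n-d}$ and $K_{d+1}$ sharing a single vertex. - $H'_{n,d}$: a clique $A$ on $n-d-1$ vertices and a set $B$ of $d+1$ further vertices inducing exactly one edge, where every vertex of $B$ has the same $d$ neighbours $a_1,\dots,a_d$ in $A$. - $G'_{n,2}$: a clique $A$ on $n-3$ vertices containing four distinct vertices $a_1,a_2,a_3,x$, and an independent set $\{b_1,b_2,b_3\}$ of further vertices with $N(b_i)=\{a_i,x\}$ for $i=1,2,3$. - $F_{n,3}$: a clique $A$ on $n-4$ vertices and a set $B$ of four further vertices inducing a perfect matching, where every vertex of $B$ is adjacent to the same two vertices of $A$. Let $\mathcal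 H_{n,d}=\{H_{n,d},H_{n,d+1},K'_{n,d},K'_{n,d+1},H'_{n,d}\}$. **Theorem 2.5.** Let $n\ge 3$ and $1\le d\le\lfloor (n-1)/2\rfloor$. Suppose that $G$ is an $n$-vertex nonhamiltonian graph with $\delta(G)\ge d$ such that there exists $k\ge 2$ for which $$N_k(G)>\max\left\{h_k(n,d+2),\ h_k\left(n,\left\lfloor\tfrac{n-1}{2}\right\rfloor\right)\right\}.$$ 1. If $d=2$, then $G$ is a subgraph of $G'_{n,2}$ or of a graph in $\mathcal H_{n,2}$. 2. If $d=3$, then $G$ is a subgraph of $F_{n,3}$ or of a graph in $\mathcal H_{n,3}$. 3. If $d=1$ or $4\le d\le\lfloor (n-1)/2\rfloor$, then $G$ is a subgraph of a graph in $\mathcal H_{n,d}$. -/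

import Mathlib

/-!
Extremal graphs for nonhamiltonian graphs with given minimum degree.
All graphs with `n` vertices are realized on `Fin n`; `SimpleGraph.fromRel` takes the symmetric,
irreflexive closure of the listed relation.
-/

namespace NonhamStability

open SimpleGraph

/-- `h_k(n, x) = C(n - x, k) + x * C(x, k - 1)`, used for `k ≥ 2` and integers `0 ≤ x ≤ n`. -/
def hk (k n x : ℕ) : ℕ := (n - x).choose k + x * x.choose (k - 1)

/-- `H_{n,d}`: a clique `A = {d, …, n-1}` on `n - d` vertices together with an independent set
`{0, …, d-1}` of `d` vertices, each adjacent to the same `d` vertices `{d, …, 2d-1}` of `A`. -/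
def graphH (n d : ℕ) : SimpleGraph (Fin n) :=
  fromRel fun u v =>
    (d ≤ u.val ∧ d ≤ v.val) ∨
    (u.val < d ∧ d ≤ v.val ∧ v.val < 2 * d)

/-- `K'_{n,d}`: the edge-disjoint union of a clique on `{d, …, n-1}` (`n - d` vertices) and a
clique on `{0, …, d}` (`d + 1` vertices), sharing the single vertex `d`. -/
def graphK' (n d : ℕ) : SimpleGraph (Fin n) :=
  fromRel fun u v =>
    (d ≤ u.val ∧ d ≤ v.val) ∨
    (u.val ≤ d ∧ v.val ≤ d)

/-- `H'_{n,d}`: a clique `A = {d+1, …, n-1}` on `n - d - 1` vertices and a set `B = {0, …, d}` of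
`d + 1` vertices which induces exactly one edge (between `0` and `1`), such that every vertex of
`B` has the same `d` neighbours `{d+1, …, 2d}` in `A`. -/
def graphH' (n d : ℕ) : SimpleGraph (Fin n) :=
  fromRel fun u v =>
    (d < u.val ∧ d < v.val) ∨
    (u.val ≤ d ∧ d < v.val ∧ v.val ≤ 2 * d) ∨
    (u.val = 0 ∧ v.val = 1)

/-- `G'_{n,2}` (for `n ≥ 7`): a clique `A = {3, …, n-1}` on `n - 3` vertices and an independent
set `B = {0, 1, 2}`; with `x = 3`, the vertex `i` of `B` has neighbourhood `{i + 4, x}`. -/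
def graphG' (n : ℕ) : SimpleGraph (Fin n) :=
  fromRel fun u v =>
    (3 ≤ u.val ∧ 3 ≤ v.val) ∨
    (u.val < 3 ∧ (v.val = 3 ∨ v.val = u.val + 4))

/-- `F_{n,3}` (for `n ≥ 6`): a clique `A = {4, …, n-1}` on `n - 4` vertices and a set
`B = {0, 1, 2, 3}` inducing the perfect matching `01, 23`; every vertex of `B` is adjacent to the
same two vertices `4, 5` of `A`. -/
def graphF (n : ℕ) : SimpleGraph (Fin n) :=
  fromRel fun u v =>
    (4 ≤ u.val ∧ 4 ≤ v.val) ∨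
    (u.val < 4 ∧ (v.val = 4 ∨ v.val = 5)) ∨
    (u.val = 0 ∧ v.val = 1) ∨
    (u.val = 2 ∧ v.val = 3)

/-- The family `{H_{n,d}, H_{n,d+1}, K'_{n,d}, K'_{n,d+1}, H'_{n,d}}`. -/
def family (n d : ℕ) : Set (SimpleGraph (Fin n)) :=
  {graphH n d, graphH n (d + 1), graphK' n d, graphK' n (d + 1), graphH' n d}

end NonhamStability

/-! The graph may be enlarged to one that is maximal without a spanning cycle: degrees and clique
counts only grow, and containment passes to subgraphs. For nonadjacent `u`, `v` such a graph has a
spanning path from `u` to `v` without crossing chords (`Sat.exists_perm`), which gives the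
conditions of Ore and Pósa.

If `r` vertices have degree at most `r`, there are at most `h_k(n, r)` cliques of size `k`, and
`h_k(n, ·)` is convex. With a Pósa-type extremal choice, the clique hypothesis therefore produces a
set `D` of fewer than `(n - 1) / 2` vertices, all of degree at most `#D`, whose complement is a
clique (`Sat.exists_lowDegree_set`); the minimum degree and convexity leave only `#D = d` and `#D =
d + 1`.

It remains to see how `D` is attached. Vertices outside `D` adjacent to all of `D` form the hub. By
Ore's bound, any other outside vertex has at most one neighbour in `D` (a private neighbour of it),
and few vertices of `D` can have several private neighbours. Two constructions of spanning cycles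
exclude most configurations. Contracting the clique outside `D` and the hub leaves a small graph, to
which Pósa's theorem applies when the hub is not too large (`Core.false_of_coreDegree`). When the
hub is only slightly smaller than `D`, one alternates between hub and `D`, helped by edges inside
`D` and private neighbours (`Core.false_of_weave`).

For `d ≥ 2` the survivors are as follows: a hub with at most one vertex and almost no other exits
from `D` makes a cut vertex (`K'`); a hub of `d - 1` vertices leaves, beyond that, only `F` and
`G'`; a hub of `d` or `d + 1` vertices gives `H` or `H'`. -/

namespace NonhamStability

open SimpleGraph Finset
open scoped Classical

/-! ### Spanning cycles, saturation, and the theorems of Ore and Pósa. -/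

section Ham
variable {V : Type*}

/-- The list `l` enumerates the vertices of a spanning cycle of `G` (an edge counts as one). -/
def HamList (G : SimpleGraph V) (l : List V) : Prop :=
  l.Nodup ∧ (∀ v, v ∈ l) ∧ (l : Cycle V).Chain G.Adj

/-- `G` has a spanning cycle, given by a list. -/
def Ham (G : SimpleGraph V) : Prop := ∃ l, HamList G l

theorem cycle_chain_iff (r : V → V → Prop) (l : List V) :
    (l : Cycle V).Chain r ↔ l.IsChain r ∧ ∀ b ∈ l.getLast?, ∀ a ∈ l.head?, r b a := by
  cases l with
  | nil => simp
  | cons a l =>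
    rw [Cycle.chain_coe_cons, ← List.cons_append, List.isChain_append]
    simp

theorem HamList.rotate {G : SimpleGraph V} {s t : List V} (h : HamList G (s ++ t)) :
    HamList G (t ++ s) := by
  obtain ⟨h1, h2, h3⟩ := h
  have hr : ((s ++ t : List V) : Cycle V) = ((t ++ s : List V) : Cycle V) :=
    Cycle.coe_eq_coe.2 List.isRotated_append
  refine ⟨List.nodup_append_comm.1 h1, fun v => ?_, hr ▸ h3⟩
  have := h2 v
  simp only [List.mem_append] at this ⊢
  tauto

theorem Ham.exists_cons {G : SimpleGraph V} (h : Ham G) (v : V) :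
    ∃ l, HamList G (v :: l) := by
  obtain ⟨l, hl⟩ := h
  obtain ⟨s, t, rfl⟩ := List.append_of_mem (hl.2.1 v)
  exact ⟨t ++ s, by simpa using hl.rotate⟩

theorem HamList.reverse {G : SimpleGraph V} {l : List V} (h : HamList G l) :
    HamList G l.reverse := by
  obtain ⟨h1, h2, h3⟩ := h
  rw [cycle_chain_iff] at h3
  refine ⟨List.nodup_reverse.2 h1, fun v => List.mem_reverse.2 (h2 v), ?_⟩
  rw [cycle_chain_iff, List.isChain_reverse]
  refine ⟨h3.1.imp fun a b hab => hab.symm, fun b hb a ha => ?_⟩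
  rw [List.getLast?_reverse] at hb
  rw [List.head?_reverse] at ha
  exact (h3.2 a ha b hb).symm

theorem Ham.isHamiltonian [Fintype V] [DecidableEq V] {G : SimpleGraph V}
    (hV : 3 ≤ Fintype.card V) (h : Ham G) : G.IsHamiltonian := by
  intro _
  have : Nonempty V := Fintype.card_pos_iff.1 (by omega)
  obtain ⟨v⟩ := this
  obtain ⟨l, h1, h2, h3⟩ := h.exists_cons v
  rw [Cycle.chain_coe_cons] at h3
  have hlen : (v :: l).length = Fintype.card V := by
    rw [← List.toFinset_card_of_nodup h1, ← Finset.card_univ]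
    congr 1
    ext x
    simpa using h2 x
  let p := Walk.ofSupport (v :: (l ++ [v])) (by simp) h3
  have hp : p.support = v :: (l ++ [v]) := Walk.support_ofSupport ..
  have hh : (v :: (l ++ [v])).head (by simp) = v := rfl
  have ht : (v :: (l ++ [v])).getLast (by simp) = v := by simp
  let q : G.Walk v v := p.copy hh ht
  have hq : q.support = v :: (l ++ [v]) := by
    rw [Walk.support_copy]
    exact hp
  have hql : q.length = Fintype.card V := by
    have := q.length_support
    rw [hq] at this
    simp at this hlen
    omega
  refine ⟨v, q, ?_⟩
  rw [Walk.isHamiltonianCycle_iff_isCycle_and_length_eq]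
  refine ⟨?_, hql⟩
  have hnn : ¬ q.Nil := by
    rw [Walk.not_nil_iff_lt_length]
    omega
  rw [Walk.isCycle_iff_isPath_tail_and_le_length, Walk.isPath_def,
    Walk.support_tail_of_not_nil _ hnn, hq]
  refine ⟨?_, by omega⟩
  simp only [List.tail_cons]
  rw [List.nodup_append_comm]
  simpa using h1

/-- `G` is maximal without a spanning cycle. -/
def Sat (G : SimpleGraph V) : Prop :=
  ¬ Ham G ∧ ∀ u v, u ≠ v → ¬ G.Adj u v → Ham (G ⊔ edge u v)

theorem exists_sat [Finite V] {G : SimpleGraph V} (h : ¬ Ham G) : ∃ H, G ≤ H ∧ Sat H := by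
  obtain ⟨H, hGH, hH⟩ := (Set.toFinite {H : SimpleGraph V | ¬ Ham H}).exists_le_maximal h
  refine ⟨H, hGH, hH.1, fun u v huv hadj => ?_⟩
  by_contra hc
  have h1 := hH.2 (y := H ⊔ edge u v) hc le_sup_left
  exact hadj (h1 (by simp [edge_adj, huv]))

/-- A spanning cycle created by adding `uv` must use that edge, and deleting it leaves the path.
With `u` placed first in the cyclic list, `v` is last or second; otherwise the cycle would already
lie in `G`. -/
theorem Sat.exists_path [Fintype V] {G : SimpleGraph V} (hG : Sat G) (hV : 3 ≤ Fintype.card V)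
    {u v : V} (huv : u ≠ v) (hadj : ¬ G.Adj u v) :
    ∃ m : List V, (u :: (m ++ [v])).Nodup ∧ (∀ x, x ∈ u :: (m ++ [v])) ∧
      (u :: (m ++ [v])).IsChain G.Adj := by
  have hlast : ∀ m : List V, HamList (G ⊔ edge u v) (u :: (m ++ [v])) → m ≠ [] →
      ∃ m : List V, (u :: (m ++ [v])).Nodup ∧ (∀ x, x ∈ u :: (m ++ [v])) ∧
      (u :: (m ++ [v])).IsChain G.Adj := by
    rintro m ⟨h1, h2, h3⟩ hm
    refine ⟨m, h1, h2, ?_⟩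
    have h4 := ((cycle_chain_iff _ _).1 h3).1
    cases m with
    | nil => exact absurd rfl hm
    | cons b m =>
      simp only [List.cons_append, List.isChain_cons_cons, List.nodup_cons] at h4 h1 ⊢
      refine ⟨?_, ?_⟩
      · have := h4.1
        simp [edge_adj] at this
        rcases this with h | h
        · exact h
        · exfalso
          have : b ≠ v := by
            rintro rfl
            simp at h1
          rcases h.1 with h | h
          · exact this h
          · exact huv h.1
      · refine List.IsChain.imp_of_mem_imp ?_ h4.2
        intro x y hx hy hxy
        have hxu : x ≠ u := by rintro rfl; exact h1.1 hx
        have hyu : y ≠ u := by rintro rfl; exact h1.1 hy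
        simp [edge_adj] at hxy
        rcases hxy with h | h
        · exact h
        · rcases h.1 with h | h
          · exact absurd h.1 hxu
          · exact absurd h.2 hyu
  obtain ⟨l, hl⟩ := (hG.2 u v huv hadj).exists_cons u
  have hlen : (u :: l).length = Fintype.card V := by
    rw [← List.toFinset_card_of_nodup hl.1, ← Finset.card_univ]
    congr 1
    ext x
    simpa using hl.2.1 x
  rcases List.eq_nil_or_concat l with rfl | ⟨l', w, rfl⟩
  · simp at hlen
    omega
  by_cases hw : w = v
  · subst hw
    simp only [List.concat_eq_append] at hl hlen
    refine hlast l' hl ?_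
    rintro rfl
    simp at hlen
    omega
  cases l' with
  | nil => simp at hlen; omega
  | cons b l' =>
    by_cases hb : b = v
    · subst hb
      simp only [List.concat_eq_append, List.cons_append] at hl hlen
      have h5 : HamList (G ⊔ edge u b) ((b :: (l' ++ [w])) ++ [u]) :=
        HamList.rotate (s := [u]) (by simpa using hl)
      have h6 := h5.reverse
      refine hlast (w :: l'.reverse) (by simpa using h6) (by simp)
    · exfalso
      refine hG.1 ⟨_, hl.1, hl.2.1, ?_⟩
      have h3 := hl.2.2
      have h1 := hl.1
      simp only [List.concat_eq_append, List.cons_append] at h1 h3 ⊢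
      rw [cycle_chain_iff] at h3 ⊢
      simp only [List.isChain_cons_cons] at h3 ⊢
      have key : ∀ x y, (G ⊔ edge u v).Adj x y → (x = u → y ≠ v) → (y = u → x ≠ v) →
          G.Adj x y := by
        intro x y h ha hb
        simp [edge_adj] at h
        rcases h with h | h
        · exact h
        · rcases h.1 with h | h
          · exact absurd h.2 (ha h.1)
          · exact absurd h.1 (hb h.2)
      have hu : u ∉ b :: (l' ++ [w]) := (List.nodup_cons.1 h1).1
      refine ⟨⟨key _ _ h3.1.1 (fun _ => hb) (fun _ => huv), ?_⟩, ?_⟩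
      · refine List.IsChain.imp_of_mem_imp ?_ h3.1.2
        intro x y hx hy hxy
        have hxu : x ≠ u := by rintro rfl; exact hu hx
        have hyu : y ≠ u := by rintro rfl; exact hu hy
        exact key x y hxy (fun h => absurd h hxu) (fun h => absurd h hyu)
      · intro x hx y hy
        have hy' : y = u := by simpa using hy.symm
        have hx' : x = w := by
          rw [← List.cons_append, ← List.cons_append, List.getLast?_concat] at hx
          simpa using hx.symm
        subst hx'
        exact key _ _ (h3.2 _ hx _ hy) (fun _ h => huv (hy'.symm.trans h)) (fun _ => hw)

/-- A maximal nonhamiltonian graph has, for nonadjacent `u`, `v`, a spanning path from `u` to `v`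
without crossing chords; `σ` is its successor function. -/
theorem Sat.exists_perm [Fintype V] {G : SimpleGraph V} (hG : Sat G) (hV : 3 ≤ Fintype.card V)
    {u v : V} (huv : u ≠ v) (hadj : ¬ G.Adj u v) :
    ∃ σ : Equiv.Perm V, σ v = u ∧
      ∀ x, x ≠ v → G.Adj x (σ x) ∧ ¬ (G.Adj u (σ x) ∧ G.Adj x v) := by
  obtain ⟨m, h1, h2, h3⟩ := hG.exists_path hV huv hadj
  set l := u :: (m ++ [v]) with hl
  -- The cyclic permutation of the path's vertex list is the successor map, closed up by `v ↦ u`.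
  refine ⟨l.formPerm, List.formPerm_cons_concat_apply_last u v m, ?_⟩ 
  intro x hx
  obtain ⟨i, hi, rfl⟩ := List.getElem_of_mem (h2 x)
  have hi2 : i + 1 < l.length := by
    by_contra hc
    apply hx
    have : i = l.length - 1 := by omega
    subst this
    simp [hl]
  rw [List.formPerm_apply_lt_getElem _ h1 i hi2]
  refine ⟨List.isChain_iff_getElem.1 h3 i hi2, fun ⟨ha, hb⟩ => hG.1 ?_⟩
  -- Crossing chords close the path up: go from `u` to `x`, jump to `v`, run back to `σ x`, and
  -- return to `u`.
  refine ⟨l.take (i+1) ++ (l.drop (i+1)).reverse, ?_, ?_, ?_⟩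
  · have : (l.take (i+1) ++ (l.drop (i+1)).reverse).Perm l := by
      conv_rhs => rw [← List.take_append_drop (i+1) l]
      exact List.Perm.append_left _ (List.reverse_perm _)
    exact this.nodup_iff.2 h1
  · intro v
    have := h2 v
    rw [← List.take_append_drop (i+1) l] at this
    rw [List.mem_append] at this ⊢
    simpa using this
  · have h4 : (l.take (i+1) ++ l.drop (i+1)).IsChain G.Adj := by
      rwa [List.take_append_drop]
    rw [List.isChain_append] at h4
    rw [cycle_chain_iff, List.isChain_append, List.isChain_reverse]
    have hlast : (l.drop (i+1)).getLast? = some v := by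
      rw [List.getLast?_drop, if_neg (by omega), hl,
        ← List.cons_append, List.getLast?_concat]
    have hfirst : (l.drop (i+1)).head? = some l[i+1] := by
      simp [List.head?_drop, hi2]
    refine ⟨⟨h4.1, h4.2.1.imp fun a b h => h.symm, ?_⟩, ?_⟩
    · intro x hx y hy
      rw [List.head?_reverse, hlast] at hy
      have hx' : x = l[i] := by
        rw [List.getLast?_take] at hx
        simp [hi] at hx
        exact hx.symm
      simp at hy
      subst hy hx'
      exact hb
    · intro x hx y hy
      rw [List.getLast?_append, List.getLast?_reverse, hfirst] at hx
      have hy' : y = u := by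
        simp [hl] at hy
        exact hy.symm
      simp at hx
      subst hx hy'
      exact ha.symm

/-- Ore's degree bound in a maximal nonhamiltonian graph. -/
theorem Sat.degree_add_le [Fintype V] {G : SimpleGraph V} (hG : Sat G)
    (hV : 3 ≤ Fintype.card V) {u v : V} (huv : u ≠ v) (hadj : ¬ G.Adj u v) :
    G.degree u + G.degree v + 1 ≤ Fintype.card V := by
  obtain ⟨σ, h1, h2⟩ := hG.exists_perm hV huv hadj
  -- No crossing chords means that no successor of a neighbour of `v` is a neighbour of `u`; nor is
  -- it `u`, whose predecessor is `v` itself.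
  have hdis : Disjoint (insert u (G.neighborFinset u)) ((G.neighborFinset v).image σ) := by
    rw [Finset.disjoint_left]
    intro x hx hx2
    obtain ⟨y, hy, rfl⟩ := Finset.mem_image.1 hx2
    rw [mem_neighborFinset] at hy
    have hyv : y ≠ v := hy.ne'
    rcases Finset.mem_insert.1 hx with h | h
    · exact hyv (σ.injective (h.trans h1.symm))
    · exact (h2 y hyv).2 ⟨(mem_neighborFinset _ _ _).1 h, hy.symm⟩
  have := Finset.card_le_univ (insert u (G.neighborFinset u) ∪ (G.neighborFinset v).image σ)
  rw [Finset.card_union_of_disjoint hdis, Finset.card_image_of_injective _ σ.injective,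
    Finset.card_insert_of_notMem (by simp), card_neighborFinset_eq_degree,
    card_neighborFinset_eq_degree] at this
  omega

theorem ham_of_complete [Fintype V] {G : SimpleGraph V} (hV : 2 ≤ Fintype.card V)
    (h : ∀ u v, u ≠ v → G.Adj u v) : Ham G := by
  refine ⟨univ.toList, Finset.nodup_toList _, by simp, ?_⟩
  rw [cycle_chain_iff]
  have hnd := Finset.nodup_toList (univ : Finset V)
  refine ⟨(List.Pairwise.imp (fun {a b} hab => h a b hab) hnd).isChain, ?_⟩
  have hlen : 2 ≤ (univ : Finset V).toList.length := by simpa using hV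
  generalize (univ : Finset V).toList = l at hnd hlen
  intro b hb a ha
  match l, hnd, hlen with
  | x :: y :: l, hnd, hlen =>
    apply h
    rintro rfl
    have hx : x = b := by simpa using ha
    subst hx
    rw [List.getLast?_cons_cons] at hb
    exact (List.nodup_cons.1 hnd).1 (List.mem_of_getLast? hb)

/-- Pósa's theorem. -/
theorem exists_low_degrees [Fintype V] {G : SimpleGraph V} (hV : 3 ≤ Fintype.card V)
    (hG : ¬ Ham G) :
    ∃ r, 1 ≤ r ∧ 2 * r < Fintype.card V ∧ r ≤ #{v | G.degree v ≤ r} := by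
  obtain ⟨H, hGH, hH⟩ := exists_sat hG
  have hne : ∃ p : V × V, p.1 ≠ p.2 ∧ ¬ H.Adj p.1 p.2 := by
    by_contra hc
    push Not at hc
    exact hH.1 (ham_of_complete (by omega) fun u v huv => hc (u, v) huv)
  obtain ⟨p, hp, hmax⟩ := Finset.exists_max_image
    ({p : V × V | p.1 ≠ p.2 ∧ ¬ H.Adj p.1 p.2} : Finset (V × V))
    (fun p => H.degree p.1 + H.degree p.2) (by
      obtain ⟨p, hp⟩ := hne
      exact ⟨p, by simpa using hp⟩)
  obtain ⟨u, v, hle, hn, hadj, hmax⟩ : ∃ u v, H.degree u ≤ H.degree v ∧ u ≠ v ∧ ¬ H.Adj u v ∧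
      ∀ x y, x ≠ y → ¬ H.Adj x y → H.degree x + H.degree y ≤ H.degree u + H.degree v := by
    simp only [Finset.mem_filter, Finset.mem_univ, true_and] at hp hmax
    rcases le_total (H.degree p.1) (H.degree p.2) with h | h
    · exact ⟨p.1, p.2, h, hp.1, hp.2, fun x y hx hy => hmax (x, y) ⟨hx, hy⟩⟩
    · refine ⟨p.2, p.1, h, hp.1.symm, fun h => hp.2 h.symm, fun x y hx hy => ?_⟩
      have := hmax (x, y) ⟨hx, hy⟩
      simp only at this
      omega
  have hore := hH.degree_add_le hV hn hadj
  have hdeg : ∀ v, G.degree v ≤ H.degree v := fun v => degree_le_of_le hGH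
  -- For `r` the smaller degree in a nonadjacent pair of maximal degree sum is taken; the `max`
  -- covers an isolated `u`, where `u` alone suffices for `r = 1`. Otherwise every nonneighbour of
  -- `v` has degree at most that of `u`, and by Ore there are enough of them.
  refine ⟨max 1 (H.degree u), le_max_left _ _, by omega, ?_⟩
  rcases Nat.eq_zero_or_pos (H.degree u) with h0 | h0
  · rw [h0]
    refine Finset.card_pos.2 ⟨u, ?_⟩
    have := hdeg u
    simp
    omega
  rw [max_eq_right h0]
  have hsub : (univ \ insert v (H.neighborFinset v)) ⊆
      ({x | G.degree x ≤ H.degree u} : Finset V) := by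
    intro x hx
    simp only [Finset.mem_sdiff, Finset.mem_univ, true_and, Finset.mem_insert, not_or,
      mem_neighborFinset] at hx
    have h1 := hmax v x (Ne.symm hx.1) hx.2
    have h2 := hdeg x
    simp
    omega
  have := Finset.card_le_card hsub
  rw [Finset.card_sdiff_of_subset (Finset.subset_univ _), Finset.card_insert_of_notMem (by simp),
    card_neighborFinset_eq_degree, Finset.card_univ] at this
  omega

/-- All degrees are at least half of the order, with up to two exceptions. -/
theorem ham_of_two_low [Fintype V] {G : SimpleGraph V} (hV : 3 ≤ Fintype.card V) (t b : V)
    (ht : 2 ≤ G.degree t)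
    (h : ∀ v, v ≠ t → Fintype.card V ≤ 2 * G.degree v ∨ (v = b ∧ 3 ≤ G.degree v)) : Ham G := by
  by_contra hc
  obtain ⟨r, h1, h2, h3⟩ := exists_low_degrees hV hc
  have hsub : ({v | G.degree v ≤ r} : Finset V) ⊆ {t, b} := by
    intro v hv
    simp only [Finset.mem_filter, Finset.mem_univ, true_and] at hv
    by_cases hvt : v = t
    · simp [hvt]
    · rcases h v hvt with h | h
      · omega
      · simp [h.1]
  -- Only `t` and `b` can be low, so `r ≤ 2`; then `b`, of degree at least 3, is not low and `r ≤
  -- 1`; then `t`, of degree at least 2, is not low either.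
  have hr : r ≤ 2 := h3.trans ((Finset.card_le_card hsub).trans Finset.card_le_two)
  have hsub : ({v | G.degree v ≤ r} : Finset V) ⊆ {t} := by
    intro v hv
    simp only [Finset.mem_filter, Finset.mem_univ, true_and] at hv
    by_cases hvt : v = t
    · simp [hvt]
    · rcases h v hvt with h | h <;> omega
  have hr : r ≤ 1 := h3.trans ((Finset.card_le_card hsub).trans (by simp))
  have hsub : ({v | G.degree v ≤ r} : Finset V) ⊆ ∅ := by
    intro v hv
    simp only [Finset.mem_filter, Finset.mem_univ, true_and] at hv
    by_cases hvt : v = t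
    · subst hvt; omega
    · rcases h v hvt with h | h <;> omega
  have := h3.trans (Finset.card_le_card hsub)
  simp at this
  omega

end Ham

/-! ### Clique counts, convexity of `h_k`, and extraction of the low-degree set. -/

section Counting
variable {V : Type*} [Fintype V]

/-- A clique either avoids `D`, or consists of some `v ∈ D` and `k - 1` of its at most `r`
neighbours. -/
theorem card_cliqueFinset_le (G : SimpleGraph V) {k r : ℕ} (D : Finset V)
    (hD : #D = r) (hdeg : ∀ v ∈ D, G.degree v ≤ r) :
    #(G.cliqueFinset k) ≤ hk k (Fintype.card V) r := by
  have hsub : G.cliqueFinset k ⊆ powersetCard k (univ \ D) ∪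
      D.biUnion fun v => (powersetCard (k - 1) (G.neighborFinset v)).image (insert v) := by
    intro s hs
    rw [mem_cliqueFinset_iff, isNClique_iff] at hs
    rw [Finset.mem_union]
    by_cases h : ∃ v ∈ D, v ∈ s
    · right
      obtain ⟨v, hv, hvs⟩ := h
      rw [Finset.mem_biUnion]
      refine ⟨v, hv, Finset.mem_image.2 ⟨s.erase v, ?_, Finset.insert_erase hvs⟩⟩
      rw [Finset.mem_powersetCard, Finset.card_erase_of_mem hvs, hs.2]
      refine ⟨fun x hx => ?_, rfl⟩
      rw [Finset.mem_erase] at hx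
      rw [mem_neighborFinset]
      exact hs.1 hvs hx.2 (Ne.symm hx.1)
    · left
      push Not at h
      rw [Finset.mem_powersetCard]
      refine ⟨fun x hx => ?_, hs.2⟩
      simp only [Finset.mem_sdiff, Finset.mem_univ, true_and]
      exact fun hxD => h x hxD hx
  refine (Finset.card_le_card hsub).trans ((Finset.card_union_le _ _).trans ?_)
  unfold hk
  refine Nat.add_le_add ?_ ?_
  · rw [Finset.card_powersetCard, Finset.card_sdiff_of_subset (Finset.subset_univ _), hD,
      Finset.card_univ]
  · refine (Finset.card_biUnion_le_card_mul _ _ (r.choose (k - 1)) fun v hv => ?_).trans ?_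
    · refine Finset.card_image_le.trans ?_
      rw [Finset.card_powersetCard, card_neighborFinset_eq_degree]
      exact Nat.choose_le_choose _ (hdeg v hv)
    · rw [hD]

/-- The increments of `h_k(n, ·)` do not decrease: the first term loses `C(n - x - 1, k - 1)`, which
shrinks with `x`, and the second term is convex. Hence once the function stops falling, it never
falls again. -/
theorem hk_succ_of_le {k n x : ℕ} (hk2 : 2 ≤ k) (hx : x + 1 < n)
    (h : hk k n x ≤ hk k n (x + 1)) : hk k n (x + 1) ≤ hk k n (x + 2) := by
  obtain ⟨j, rfl⟩ : ∃ j, k = j + 2 := ⟨k - 2, by omega⟩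
  obtain ⟨m, rfl⟩ : ∃ m, n = m + (x + 2) := ⟨n - (x + 2), by omega⟩
  unfold hk at *
  rw [show m + (x + 2) - x = m + 1 + 1 by omega, show m + (x + 2) - (x + 1) = m + 1 by omega] at h
  rw [show m + (x + 2) - (x + 1) = m + 1 by omega, show m + (x + 2) - (x + 2) = m by omega]
  rw [show j + 2 - 1 = j + 1 by omega] at *
  have e1 : (m + 1 + 1).choose (j + 2) = (m + 1).choose (j + 1) + (m + 1).choose (j + 2) :=
    Nat.choose_succ_succ _ _
  have e2 : (m + 1).choose (j + 2) = m.choose (j + 1) + m.choose (j + 2) :=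
    Nat.choose_succ_succ _ _
  have e3 : (m + 1).choose (j + 1) = m.choose j + m.choose (j + 1) :=
    Nat.choose_succ_succ _ _
  have e4 : (x + 2).choose (j + 1) = (x + 1).choose j + (x + 1).choose (j + 1) :=
    Nat.choose_succ_succ _ _
  have e5 : (x + 1).choose (j + 1) = x.choose j + x.choose (j + 1) :=
    Nat.choose_succ_succ _ _
  have e6 : x.choose j ≤ (x + 1).choose j := Nat.choose_le_choose _ (by omega)
  rw [e4, e5]
  rw [e1, e2, e3, e5] at h
  rw [e2]
  nlinarith [Nat.mul_le_mul_left (x + 1) e6]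

/-- Convexity of `h_k(n, ·)`. -/
theorem hk_le_max {k n a x b : ℕ} (hk2 : 2 ≤ k) (hax : a ≤ x) (hxb : x ≤ b) (hb : b ≤ n) :
    hk k n x ≤ max (hk k n a) (hk k n b) := by
  by_contra hc
  rw [not_le, max_lt_iff] at hc
  have hstep : ∃ y, a ≤ y ∧ y < x ∧ hk k n y ≤ hk k n (y + 1) := by
    by_contra h
    push Not at h
    have : ∀ z, a ≤ z → z ≤ x → hk k n z ≤ hk k n a := by
      intro z hz
      induction z, hz using Nat.le_induction with
      | base => exact fun _ => le_rfl
      | succ z hz ih => exact fun hzx => (h z hz (by omega)).le.trans (ih (by omega))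
    have := this x hax le_rfl
    omega
  obtain ⟨y, hay, hyx, hy⟩ := hstep
  have hmono : ∀ z, y ≤ z → z < n → hk k n z ≤ hk k n (z + 1) := by
    intro z hz
    induction z, hz using Nat.le_induction with
    | base => exact fun _ => hy
    | succ z hz ih => exact fun hzn => hk_succ_of_le hk2 hzn (ih (by omega))
  have : ∀ z, x ≤ z → z ≤ n → hk k n x ≤ hk k n z := by
    intro z hz
    induction z, hz using Nat.le_induction with
    | base => exact fun _ => le_rfl
    | succ z hz ih => exact fun hzn => (ih (by omega)).trans (hmono z (by omega) (by omega))
  have := this b hxb hb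
  omega

/-- A maximal nonhamiltonian graph with many cliques is a clique plus few vertices of small
degree. -/
theorem Sat.exists_lowDegree_set {G : SimpleGraph V} (hG : Sat G) {n k : ℕ} (hn : 3 ≤ n)
    (hV : Fintype.card V = n)
    (hcl : hk k n ((n - 1) / 2) < #(G.cliqueFinset k)) :
    ∃ D : Finset V, 1 ≤ #D ∧ #D < (n - 1) / 2 ∧ (∀ v ∈ D, G.degree v ≤ #D) ∧
      ∀ u v, u ∉ D → v ∉ D → u ≠ v → G.Adj u v := by
  set m := (n - 1) / 2 with hm
  have hmlow : #{v | G.degree v ≤ m} < m := by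
    by_contra hc
    push Not at hc
    obtain ⟨D, hD, hDc⟩ := Finset.exists_subset_card_eq hc
    have := card_cliqueFinset_le G (k := k) D hDc
      (fun v hv => by simpa using hD hv)
    rw [hV] at this
    omega
  obtain ⟨r₀, h1, h2, h3⟩ := exists_low_degrees (by omega) hG.1
  have hS : (({r ∈ Finset.Icc 1 m | r ≤ #{v | G.degree v ≤ r}}) : Finset ℕ).Nonempty :=
    ⟨r₀, by simp only [Finset.mem_filter, Finset.mem_Icc]; omega⟩
  obtain ⟨r, hr, hmax⟩ := Finset.exists_max_image _ id hS
  simp only [Finset.mem_filter, Finset.mem_Icc, id] at hr hmax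
  have hrm : r < m := by
    rcases hr.1.2.lt_or_eq with h | h
    · exact h
    · rw [h] at hr; omega
  have hmono : ∀ {a b : ℕ}, a ≤ b → #{v | G.degree v ≤ a} ≤ #{v | G.degree v ≤ b} := by
    intro a b hab
    refine Finset.card_le_card fun v hv => ?_
    simp only [Finset.mem_filter, Finset.mem_univ, true_and] at hv ⊢
    omega
  have hDr : #{v | G.degree v ≤ r} = r := by
    refine le_antisymm ?_ hr.2
    by_contra hc
    have h4 := hmono (show r ≤ r + 1 by omega)
    have := hmax (r + 1) (by omega)
    omega
  refine ⟨({v | G.degree v ≤ r} : Finset V), by omega, by omega, fun v hv => ?_, ?_⟩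
  · rw [hDr]
    simpa using hv
  by_contra hc
  have hne : ({p : V × V | r < G.degree p.1 ∧ r < G.degree p.2 ∧ p.1 ≠ p.2 ∧ ¬ G.Adj p.1 p.2} :
      Finset (V × V)).Nonempty := by
    push Not at hc
    obtain ⟨u, v, hu, hv, h⟩ := hc
    exact ⟨(u, v), by simpa using ⟨by simpa using hu, by simpa using hv, h⟩⟩
  -- If the complement of `D` is not a clique, take `x` of largest degree among its vertices with a
  -- nonneighbour there. By Ore, the `n - 1 - deg x` nonneighbours of `x` all have degree at most
  -- their number, which is at least `deg y > r`.
  obtain ⟨⟨x, y⟩, hp, hpmax⟩ := Finset.exists_max_image _ (fun p => G.degree p.1) hne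
  simp only [Finset.mem_filter, Finset.mem_univ, true_and, Prod.forall] at hp hpmax
  obtain ⟨hx, hy, hxy, hadj⟩ := hp
  set D' := univ \ insert x (G.neighborFinset x) with hD'
  have hD'c : #D' = n - (G.degree x + 1) := by
    rw [hD', Finset.card_sdiff_of_subset (Finset.subset_univ _),
      Finset.card_insert_of_notMem (by simp), card_neighborFinset_eq_degree, Finset.card_univ, hV]
  have hD'mem : ∀ z, z ∈ D' ↔ z ≠ x ∧ ¬ G.Adj x z := by
    intro z
    simp [hD', not_or]
  have hyo := hG.degree_add_le (by omega) hxy hadj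
  have hlow : ∀ z ∈ D', G.degree z ≤ #D' := by
    intro z hz
    rw [hD'mem] at hz
    have := hG.degree_add_le (by omega) (Ne.symm hz.1) hz.2
    omega
  -- If `#D' ≤ m`, then `#D'` contradicts the maximality of `r`. Otherwise `deg x ≤ m`, so by the
  -- choice of `x` more than `m` vertices have degree at most `m`, contradicting `hmlow`.
  by_cases hD'm : #D' ≤ m
  · have : #D' ≤ #{v | G.degree v ≤ #D'} :=
      Finset.card_le_card fun z hz => by simpa using hlow z hz
    have := hmax #D' (by omega)
    omega
  · have : #D' ≤ #{v | G.degree v ≤ m} := by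
      refine Finset.card_le_card fun z hz => ?_
      simp only [Finset.mem_filter, Finset.mem_univ, true_and]
      by_cases hzr : G.degree z ≤ r
      · omega
      · rw [hD'mem] at hz
        have := hpmax z x ⟨by omega, hx, hz.1, fun h => hz.2 h.symm⟩
        omega
    omega

end Counting

/-! ### Contracting a clique to a single vertex. -/

section Collapse
variable {V : Type*}

/-- The graph obtained from `G` by identifying all vertices of `T` with one new vertex. -/
def collapse (G : SimpleGraph V) (T : Finset V) : SimpleGraph (Option {v // v ∉ T}) :=
  fromRel fun x y => match x, y with
    | some u, some v => G.Adj u v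
    | none, some v => ∃ a ∈ T, G.Adj a v
    | _, _ => False

theorem collapse_adj_some {G : SimpleGraph V} {T : Finset V} {u v : {v // v ∉ T}} :
    (collapse G T).Adj (some u) (some v) ↔ G.Adj u v := by
  simp only [collapse, fromRel_adj]
  constructor
  · rintro ⟨_, h | h⟩
    · exact h
    · exact h.symm
  · exact fun h => ⟨fun he => h.ne (congrArg Subtype.val (Option.some.inj he)), Or.inl h⟩

theorem collapse_adj_none {G : SimpleGraph V} {T : Finset V} {v : {v // v ∉ T}} :
    (collapse G T).Adj none (some v) ↔ ∃ a ∈ T, G.Adj a v := by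
  simp [collapse, fromRel_adj]

theorem exists_map_some {α : Type*} : ∀ l : List (Option α), none ∉ l → ∃ m : List α, l = m.map some
  | [], _ => ⟨[], rfl⟩
  | none :: l, h => by simp at h
  | some a :: l, h => by
    obtain ⟨m, rfl⟩ := exists_map_some l (by simpa using h)
    exact ⟨a :: m, rfl⟩

theorem isChain_toList {G : SimpleGraph V} (S : Finset V)
    (h : ∀ u ∈ S, ∀ v ∈ S, u ≠ v → G.Adj u v) : S.toList.IsChain G.Adj := by
  have hnd := Finset.nodup_toList S
  refine List.Pairwise.isChain (List.Pairwise.imp_of_mem ?_ hnd)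
  intro a b ha hb hab
  exact h a (by simpa using ha) b (by simpa using hb) hab

/-- The contracted vertex has two distinct cycle neighbours `p` and `q`. Because they have distinct
attachment points `a`, `a'` in the clique `T`, the vertex can be expanded into a path from `a'` to
`a` through all of `T`. -/
theorem ham_of_collapse [Fintype V] {G : SimpleGraph V} {T : Finset V}
    (hT : ∀ u ∈ T, ∀ v ∈ T, u ≠ v → G.Adj u v)
    (hcard : #T + 2 ≤ Fintype.card V)
    (hex : ∀ p q, p ∉ T → q ∉ T → p ≠ q → (∃ a ∈ T, G.Adj a p) → (∃ a ∈ T, G.Adj a q) →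
      ∃ a ∈ T, ∃ a' ∈ T, a ≠ a' ∧ G.Adj a p ∧ G.Adj a' q)
    (hC : Ham (collapse G T)) : Ham G := by
  obtain ⟨l, hl⟩ := hC.exists_cons none
  obtain ⟨m, rfl⟩ := exists_map_some l (List.nodup_cons.1 hl.1).1
  obtain ⟨hnd, hmem, hch⟩ := hl
  have hmnd : m.Nodup := List.Nodup.of_map _ (List.nodup_cons.1 hnd).2
  have hmem' : ∀ v : {v // v ∉ T}, v ∈ m := by
    intro v
    simpa using hmem (some v)
  have hlen : m.length = Fintype.card V - #T := by
    rw [← List.toFinset_card_of_nodup hmnd]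
    have : m.toFinset = univ := by ext v; simpa using hmem' v
    rw [this, Finset.card_univ, Fintype.card_subtype_compl]
    simp
  rw [Cycle.chain_coe_cons] at hch
  obtain ⟨p, m, rfl⟩ : ∃ p m', m = p :: m' := by
    cases m with
    | nil => simp at hlen; omega
    | cons p m => exact ⟨p, m, rfl⟩
  obtain ⟨m, q, rfl⟩ : ∃ m' q, m = m' ++ [q] := by
    rcases List.eq_nil_or_concat m with rfl | ⟨m', q, rfl⟩
    · simp at hlen; omega
    · exact ⟨m', q, by simp⟩
  have hpq : p ≠ q := by
    rintro rfl
    simp at hmnd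
  simp only [List.map_cons, List.map_append, List.map_nil, List.cons_append, List.append_assoc,
    List.nil_append, List.isChain_cons_cons] at hch
  have hch2 : (((p :: (m ++ [q])).map some) ++ [none]).IsChain (collapse G T).Adj := by
    simpa using hch.2
  rw [List.isChain_append] at hch2
  have hp := collapse_adj_none.1 hch.1
  have hq := hch2.2.2 (some q) (by
    rw [← List.cons_append, List.map_append, List.map_singleton, List.getLast?_concat]
    simp) none (by simp)
  have hq := collapse_adj_none.1 hq.symm
  have hpath := (List.isChain_map some).1 hch2.1
  simp only [collapse_adj_some] at hpath
  obtain ⟨a, ha, a', ha', haa, hap, haq⟩ := hex p q p.2 q.2 (fun h => hpq (Subtype.ext h)) hp hq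
  refine ⟨(p :: (m ++ [q])).map Subtype.val ++ (a' :: ((T.erase a).erase a').toList ++ [a]),
    ?_, ?_, ?_⟩
  · rw [List.nodup_append]
    refine ⟨hmnd.map Subtype.val_injective, ?_, ?_⟩
    · rw [List.nodup_append]
      refine ⟨?_, by simp, ?_⟩
      · rw [List.nodup_cons]
        exact ⟨by simp, Finset.nodup_toList _⟩
      · intro x hx y hy
        simp at hx hy
        rintro rfl
        subst hy
        rcases hx with h | h
        · exact haa h
        · exact h.2.1 rfl
    · intro x hx y hy
      obtain ⟨z, -, rfl⟩ := List.mem_map.1 hx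
      rintro rfl
      apply z.2
      simp at hy
      rcases hy with h | h | h
      · rw [h]; exact ha'
      · exact h.2.2
      · rw [h]; exact ha
  · intro v
    by_cases hv : v ∈ T
    · simp
      tauto
    · have := List.mem_map_of_mem (f := Subtype.val) (hmem' ⟨v, hv⟩)
      rw [List.mem_append]
      exact Or.inl this
  · rw [cycle_chain_iff]
    constructor
    · rw [List.isChain_append]
      refine ⟨(List.isChain_map _).2 hpath, ?_, ?_⟩
      · have hc := isChain_toList ((T.erase a).erase a') (G := G) (by
          intro u hu v hv
          simp only [Finset.mem_erase] at hu hv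
          exact hT u hu.2.2 v hv.2.2)
        rw [List.isChain_append, List.isChain_cons]
        refine ⟨⟨fun y hy => ?_, hc⟩, by simp, ?_⟩
        · have := List.mem_of_mem_head? hy
          simp at this
          exact hT _ ha' _ this.2.2 (Ne.symm this.1)
        · intro x hx y hy
          have := List.mem_of_getLast? hx
          simp at this hy
          subst hy
          rcases this with h | h
          · subst h; exact hT _ ha' _ ha (Ne.symm haa)
          · exact hT _ h.2.2 _ ha h.2.1
      · intro x hx y hy
        rw [← List.cons_append, List.map_append, List.map_singleton,
          List.getLast?_concat] at hx
        simp at hx hy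
        subst hx hy
        exact haq.symm
    · intro x hx y hy
      rw [← List.append_assoc, List.getLast?_concat] at hx
      simp at hx hy
      subst hx hy
      exact hap

/-- The degree of a vertex outside `T` after collapsing `T`. -/
noncomputable def collapseDegree [Fintype V] (G : SimpleGraph V) (T : Finset V) (v : V) : ℕ :=
  #(G.neighborFinset v \ T) + if ∃ a ∈ T, G.Adj a v then 1 else 0

theorem card_le_degree_collapse_none [Fintype V] (G : SimpleGraph V) (T : Finset V) :
    #{v | v ∉ T ∧ ∃ a ∈ T, G.Adj a v} ≤ (collapse G T).degree none := by
  rw [← card_neighborFinset_eq_degree]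
  refine Finset.card_le_card_of_injOn
    (fun v => if h : v ∉ T then some ⟨v, h⟩ else none) ?_ ?_
  · intro v hv
    simp only [Finset.coe_filter, Finset.mem_univ, true_and, Set.mem_ofPred_eq] at hv
    simp only [hv.1, not_false_eq_true, dite_true, Finset.mem_coe, mem_neighborFinset]
    exact collapse_adj_none.2 hv.2
  · intro v hv w hw hvw
    simp only [Finset.coe_filter, Finset.mem_univ, true_and, Set.mem_ofPred_eq] at hv hw
    simpa [hv.1, hw.1] using hvw

theorem collapseDegree_le [Fintype V] (G : SimpleGraph V) (T : Finset V) (v : {v // v ∉ T}) :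
    collapseDegree G T v ≤ (collapse G T).degree (some v) := by
  rw [← card_neighborFinset_eq_degree]
  have h1 : #(G.neighborFinset v \ T) ≤
      #(((collapse G T).neighborFinset (some v)).erase none) := by
    refine Finset.card_le_card_of_injOn
      (fun v => if h : v ∉ T then some ⟨v, h⟩ else none) ?_ ?_
    · intro w hw
      simp only [Finset.coe_sdiff, Set.mem_sdiff, Finset.mem_coe, mem_neighborFinset] at hw
      simp only [hw.2, not_false_eq_true, dite_true, Finset.mem_coe, mem_neighborFinset,
        Finset.mem_erase, ne_eq, reduceCtorEq, true_and]
      exact collapse_adj_some.2 hw.1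
    · intro v hv w hw hvw
      simp only [Finset.coe_sdiff, Set.mem_sdiff, Finset.mem_coe, mem_neighborFinset] at hv hw
      simpa [hv.2, hw.2] using hvw
  unfold collapseDegree
  split_ifs with h
  · have : none ∈ (collapse G T).neighborFinset (some v) := by
      rw [mem_neighborFinset]
      exact (collapse_adj_none.2 h).symm
    rw [Finset.card_erase_of_mem this] at h1
    have := Finset.card_pos.2 ⟨_, this⟩
    omega
  · exact h1.trans (Finset.card_le_card (Finset.erase_subset _ _))

/-- A degree condition, after collapsing a clique, for the existence of a spanning cycle. -/
theorem ham_of_collapseDegree [Fintype V] {G : SimpleGraph V} {T : Finset V} (b : V)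
    (hT : ∀ u ∈ T, ∀ v ∈ T, u ≠ v → G.Adj u v)
    (hex : ∀ p q, p ∉ T → q ∉ T → p ≠ q → (∃ a ∈ T, G.Adj a p) → (∃ a ∈ T, G.Adj a q) →
      ∃ a ∈ T, ∃ a' ∈ T, a ≠ a' ∧ G.Adj a p ∧ G.Adj a' q)
    (hnone : 2 ≤ #{v | v ∉ T ∧ ∃ a ∈ T, G.Adj a v})
    (hsome : ∀ v, v ∉ T → Fintype.card V + 1 ≤ 2 * collapseDegree G T v + #T ∨
      (v = b ∧ 3 ≤ collapseDegree G T v)) : Ham G := by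
  have hsub : ({v | v ∉ T ∧ ∃ a ∈ T, G.Adj a v} : Finset V) ⊆ univ \ T := by
    intro v hv
    simp only [Finset.mem_filter, Finset.mem_univ, true_and] at hv
    simpa using hv.1
  have hc := Finset.card_le_card hsub
  rw [Finset.card_sdiff_of_subset (Finset.subset_univ _), Finset.card_univ] at hc
  have hTV := Finset.card_le_univ T
  have hN : Fintype.card (Option {v // v ∉ T}) = Fintype.card V - #T + 1 := by
    rw [Fintype.card_option, Fintype.card_subtype_compl]
    simp
  -- The contracted graph has `|V| - #T + 1` vertices; its contracted vertex is the exception that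
  -- needs only degree 2. If `b ∈ T`, the second exception defaults to that same vertex.
  refine ham_of_collapse hT (by omega) hex
    (ham_of_two_low (by omega) none (if h : b ∉ T then some ⟨b, h⟩ else none)
      (hnone.trans (card_le_degree_collapse_none G T)) ?_)
  intro x hx
  cases x with
  | none => exact absurd rfl hx
  | some v =>
    have h1 := collapseDegree_le G T v
    rcases hsome v v.2 with h | h
    · left; omega
    · right
      obtain ⟨v, hv⟩ := v
      obtain ⟨rfl, h⟩ := h
      exact ⟨by simp [hv], by omega⟩

end Collapse

/-! ### Spanning cycles obtained by alternating between two sets. -/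

section Weave
variable {V : Type*}

/-- Alternate the entries of two lists. -/
def interleave : List V → List V → List V
  | a :: as, b :: bs => a :: b :: interleave as bs
  | _, _ => []

theorem interleave_perm : ∀ as bs : List V, as.length = bs.length →
    (interleave as bs).Perm (as ++ bs)
  | [], [], _ => List.Perm.nil
  | a :: as, b :: bs, h => by
    rw [interleave, List.cons_append]
    refine List.Perm.cons a ?_
    refine ((interleave_perm as bs (by simpa using h)).cons b).trans ?_
    exact List.perm_middle.symm
  | [], _ :: _, h => by simp at h
  | _ :: _, [], h => by simp at h

theorem interleave_isChain {G : SimpleGraph V} {S D : Finset V}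
    (hS : ∀ a ∈ S, ∀ b ∈ D, G.Adj a b) : ∀ as bs : List V, as.length = bs.length →
    (∀ a ∈ as, a ∈ S) → (∀ b ∈ bs, b ∈ D) → ∀ w ∈ D,
    (w :: interleave as bs).IsChain G.Adj ∧
      ∀ z ∈ (w :: interleave as bs).getLast?, z ∈ D
  | [], [], _, _, _, w, hw => by simpa [interleave] using hw
  | a :: as, b :: bs, h, ha, hb, w, hw => by
    have ih := interleave_isChain hS as bs (by simpa using h)
      (fun x hx => ha x (List.mem_cons_of_mem _ hx)) (fun x hx => hb x (List.mem_cons_of_mem _ hx))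
      b (hb b (by simp))
    rw [interleave, List.isChain_cons_cons, List.isChain_cons_cons, List.getLast?_cons_cons,
      List.getLast?_cons_cons]
    exact ⟨⟨(hS a (ha a (by simp)) w hw).symm, hS a (ha a (by simp)) b (hb b (by simp)), ih.1⟩,
      ih.2⟩
  | [], _ :: _, h, _, _, _, _ => by simp at h
  | _ :: _, [], h, _, _, _, _ => by simp at h

theorem card_sdiff_toFinset (S : Finset V) {l : List V} (hl : l.Nodup) :
    #(S \ l.toFinset) + l.countP (· ∈ S) = #S := by
  rw [← Finset.card_sdiff_add_card_inter S l.toFinset]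
  congr 1
  rw [List.countP_eq_length_filter, ← List.toFinset_card_of_nodup (hl.filter _)]
  congr 1
  ext x
  simp [and_comm]

/-- Complete two paths `X₂` and `X₁` to a spanning cycle by alternating between the remaining
vertices of `D` and vertices of `S` in between, and by appending the rest of the clique. -/
theorem ham_of_weave [Fintype V] {G : SimpleGraph V} {S D : Finset V}
    (hA : ∀ u v, u ∉ D → v ∉ D → u ≠ v → G.Adj u v)
    (hSD : ∀ a ∈ S, a ∉ D) (hS : ∀ a ∈ S, ∀ b ∈ D, G.Adj a b)
    {X₁ X₂ : List V} {a x y w : V}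
    (h₁ : X₁.IsChain G.Adj) (h₂ : X₂.IsChain G.Adj) (hnd : (X₁ ++ X₂).Nodup)
    (ha : X₁.head? = some a) (haS : a ∈ S) (hx : X₁.getLast? = some x) (hxD : x ∉ D)
    (hy : X₂.head? = some y) (hyD : y ∉ D) (hw : X₂.getLast? = some w) (hwD : w ∈ D)
    (hcount : #D + (X₁ ++ X₂).countP (· ∈ S) ≤ #S + (X₁ ++ X₂).countP (· ∈ D)) : Ham G := by
  have hcD := card_sdiff_toFinset D hnd
  have hcS := card_sdiff_toFinset S hnd
  obtain ⟨R, hRS, hRc⟩ := Finset.exists_subset_card_eq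
    (show #(D \ (X₁ ++ X₂).toFinset) ≤ #(S \ (X₁ ++ X₂).toFinset) by omega)
  set U := D \ (X₁ ++ X₂).toFinset with hU
  have hUmem : ∀ v, v ∈ U ↔ v ∈ D ∧ v ∉ X₁ ∧ v ∉ X₂ := by intro v; simp [hU]
  have hRmem : ∀ v ∈ R, v ∈ S ∧ v ∉ X₁ ∧ v ∉ X₂ := by
    intro v hv
    simpa using hRS hv
  set I := interleave R.toList U.toList with hI
  have hlen : R.toList.length = U.toList.length := by simpa using hRc
  have hIp : I.Perm (R.toList ++ U.toList) := interleave_perm _ _ hlen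
  have hImem : ∀ v, v ∈ I ↔ v ∈ R ∨ v ∈ U := by intro v; simp [hIp.mem_iff]
  obtain ⟨hIc, hIl⟩ := interleave_isChain hS R.toList U.toList hlen
    (fun a ha => (hRmem a (by simpa using ha)).1)
    (fun b hb => ((hUmem b).1 (by simpa using hb)).1) w hwD
  rw [← hI] at hIc hIl
  rw [List.isChain_cons] at hIc
  set W : Finset V := univ.filter fun v => v ∉ D ∧ v ∉ X₁ ∧ v ∉ X₂ ∧ v ∉ R with hW
  have hWmem : ∀ v, v ∈ W ↔ v ∉ D ∧ v ∉ X₁ ∧ v ∉ X₂ ∧ v ∉ R := by intro v; simp [hW]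
  have hWc : W.toList.IsChain G.Adj := isChain_toList W fun u hu v hv =>
    hA u v ((hWmem u).1 hu).1 ((hWmem v).1 hv).1
  rw [List.nodup_append] at hnd
  have hyX : y ∈ X₂ := List.mem_of_mem_head? hy
  have hxX : x ∈ X₁ := List.mem_of_getLast? hx
  -- The cycle runs through `X₂`, ending at `w ∈ D`; then alternately through `R ⊆ S` and the rest
  -- of `D`, ending in `D`; then through `X₁`, starting in `S`; then through the unused clique
  -- vertices `W`, and back to `y`.
  refine ⟨(X₂ ++ I) ++ (X₁ ++ W.toList), ?_, ?_, ?_⟩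
  · rw [List.nodup_append, List.nodup_append, List.nodup_append]
    refine ⟨⟨hnd.2.1, ?_, ?_⟩, ⟨hnd.1, Finset.nodup_toList _, ?_⟩, ?_⟩
    · rw [hIp.nodup_iff, List.nodup_append]
      refine ⟨Finset.nodup_toList _, Finset.nodup_toList _, ?_⟩
      rintro u hu v hv rfl
      rw [Finset.mem_toList] at hu hv
      exact hSD u (hRmem u hu).1 ((hUmem u).1 hv).1
    · rintro u hu v hv rfl
      rcases (hImem u).1 hv with h | h
      · exact (hRmem u h).2.2 hu
      · exact ((hUmem u).1 h).2.2 hu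
    · rintro u hu v hv rfl
      rw [Finset.mem_toList, hWmem] at hv
      exact hv.2.1 hu
    · rintro u hu v hv rfl
      rw [List.mem_append, hImem] at hu
      rw [List.mem_append, Finset.mem_toList, hWmem] at hv
      rcases hv with hv | hv
      · rcases hu with hu | hu | hu
        · exact hnd.2.2 u hv u hu rfl
        · exact (hRmem u hu).2.1 hv
        · exact ((hUmem u).1 hu).2.1 hv
      · rcases hu with hu | hu | hu
        · exact hv.2.2.1 hu
        · exact hv.2.2.2 hu
        · exact hv.1 ((hUmem u).1 hu).1
  · intro v
    simp only [List.mem_append, hImem, hUmem, Finset.mem_toList, hWmem]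
    tauto
  · have hlast : ∀ z ∈ (X₂ ++ I).getLast?, z ∈ D := by
      intro z hz
      rw [List.getLast?_append, hw] at hz
      refine hIl z ?_
      rw [List.getLast?_cons]
      cases h : I.getLast? with
      | none => rw [h] at hz; simpa using hz
      | some t => rw [h] at hz; simpa using hz
    have hne : ∀ z ∈ (X₁ ++ W.toList).getLast?, z ∉ D ∧ z ≠ y := by
      intro z hz
      rw [List.getLast?_append, hx] at hz
      cases h : W.toList.getLast? with
      | none =>
        rw [h] at hz
        have : x = z := by simpa using hz
        subst this
        exact ⟨hxD, hnd.2.2 x hxX y hyX⟩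
      | some t =>
        rw [h] at hz
        have : t = z := by simpa using hz
        subst this
        have h4 := List.mem_of_getLast? h
        rw [Finset.mem_toList, hWmem] at h4
        exact ⟨h4.1, fun he => h4.2.2.1 (he ▸ hyX)⟩
    rw [cycle_chain_iff, List.isChain_append, List.isChain_append, List.isChain_append]
    refine ⟨⟨⟨h₂, hIc.2, ?_⟩, ⟨h₁, hWc, ?_⟩, ?_⟩, ?_⟩
    · intro u hu v hv
      rw [hw] at hu
      have : w = u := by simpa using hu
      subst this
      exact hIc.1 v hv
    · intro u hu v hv
      rw [hx] at hu
      have : x = u := by simpa using hu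
      subst this
      have h4 := List.mem_of_mem_head? hv
      rw [Finset.mem_toList, hWmem] at h4
      exact hA _ _ hxD h4.1 fun he => h4.2.1 (he ▸ hxX)
    · intro u hu v hv
      rw [List.head?_append, ha] at hv
      have : a = v := by simpa using hv
      subst this
      exact (hS a haS u (hlast u hu)).symm
    · intro u hu v hv
      rw [List.getLast?_append] at hu
      rw [List.append_assoc, List.head?_append, hy] at hv
      have : y = v := by simpa using hv
      subst this
      have hu' : u ∈ (X₁ ++ W.toList).getLast? := by
        cases h : (X₁ ++ W.toList).getLast? with
        | none =>
          rw [List.getLast?_eq_none_iff] at h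
          simp at h
          rw [h.1] at hxX
          simp at hxX
        | some t => rw [h] at hu; simpa using hu
      exact hA u y (hne u hu').1 hyD (hne u hu').2

end Weave

/-! ### Recognising subgraphs of the extremal graphs. -/

section Embeddings
variable {V : Type*} [Fintype V] {G : SimpleGraph V} {n : ℕ}

/-- The vertices of `pre` are numbered in order and the others arbitrarily afterwards. As the
extremal graphs are cliques on the late indices, only adjacencies of the listed vertices then
matter. -/
theorem isContained_of_prefix (hV : Fintype.card V = n) {pre : List V} (hpre : pre.Nodup)
    {R : ℕ → ℕ → Prop}
    (h : ∀ f : V → ℕ, (∀ v ∈ pre, f v = pre.idxOf v) → (∀ v, v ∉ pre → pre.length ≤ f v) →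
      ∀ u v, G.Adj u v → R (f u) (f v) ∨ R (f v) (f u)) :
    G.IsContained (fromRel fun u v : Fin n => R u.val v.val) := by
  set l := pre ++ (univ \ pre.toFinset).toList with hl
  have hmem : ∀ v, v ∈ l := by
    intro v
    rw [hl, List.mem_append, Finset.mem_toList, Finset.mem_sdiff, List.mem_toFinset]
    simp only [Finset.mem_univ, true_and]
    tauto
  have hnd : l.Nodup := by
    rw [hl, List.nodup_append]
    refine ⟨hpre, Finset.nodup_toList _, ?_⟩
    rintro u hu v hv rfl
    rw [Finset.mem_toList, Finset.mem_sdiff, List.mem_toFinset] at hv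
    exact hv.2 hu
  have hlen : l.length = n := by
    rw [← List.toFinset_card_of_nodup hnd, ← hV, ← Finset.card_univ]
    congr 1
    ext v
    simpa using hmem v
  have hlt : ∀ v, l.idxOf v < n := fun v => hlen ▸ List.idxOf_lt_length_iff.2 (hmem v)
  have hinj : ∀ u v, l.idxOf u = l.idxOf v → u = v :=
    fun u v huv => (List.idxOf_inj (hmem u)).1 huv
  have key := h (fun v => l.idxOf v) (fun v hv => by
    simp only [hl]
    exact List.idxOf_append_of_mem hv) (fun v hv => by
    simp only [hl]
    rw [List.idxOf_append_of_notMem hv]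
    omega)
  refine ⟨⟨⟨fun v => ⟨l.idxOf v, hlt v⟩, ?_⟩, ?_⟩⟩
  · intro u v huv
    rw [fromRel_adj]
    refine ⟨fun he => huv.ne (hinj u v ?_), key u v huv⟩
    simpa using he
  · intro u v huv
    refine hinj u v ?_
    simpa using huv

theorem idxOf_toList_append {V : Type*} {S : Finset V} {l : List V} {v : V} :
    (v ∈ S → (S.toList ++ l).idxOf v < #S) ∧
      (v ∉ S → (S.toList ++ l).idxOf v = #S + l.idxOf v) := by
  constructor
  · intro h
    have h' : v ∈ S.toList := by simpa using h
    rw [List.idxOf_append_of_mem h', ← Finset.length_toList]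
    exact List.idxOf_lt_length_iff.2 h'
  · intro h
    rw [List.idxOf_append_of_notMem (by simpa using h), Finset.length_toList]

theorem isContained_graphH (hV : Fintype.card V = n) {x : ℕ} {B S : Finset V} (hB : #B = x)
    (hS : #S = x) (hBS : ∀ v ∈ B, v ∉ S) (h : ∀ u v, G.Adj u v → u ∈ B → v ∈ S) :
    G.IsContained (graphH n x) := by
  refine isContained_of_prefix (R := fun u v => (x ≤ u ∧ x ≤ v) ∨ (u < x ∧ x ≤ v ∧ v < 2 * x))
    hV (pre := B.toList ++ S.toList) ?_ ?_
  · rw [List.nodup_append]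
    refine ⟨Finset.nodup_toList _, Finset.nodup_toList _, ?_⟩
    rintro u hu v hv rfl
    rw [Finset.mem_toList] at hu hv
    exact hBS u hu hv
  intro f h1 h2
  have hfB : ∀ v ∈ B, f v < x := by
    intro v hv
    rw [h1 v (by simp [hv]), ← hB]
    exact idxOf_toList_append.1 hv
  have hfS : ∀ v ∈ S, f v < 2 * x := by
    intro v hv
    rw [h1 v (by simp [hv]), idxOf_toList_append.2 fun h => hBS v h hv]
    have : S.toList.idxOf v < S.toList.length := List.idxOf_lt_length_iff.2 (by simpa using hv)
    rw [Finset.length_toList] at this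
    omega
  have hfn : ∀ v, v ∉ B → x ≤ f v := by
    intro v hv
    by_cases hvS : v ∈ S
    · rw [h1 v (by simp [hvS]), idxOf_toList_append.2 hv]
      omega
    · have := h2 v (by simp [hv, hvS])
      simp at this
      omega
  intro u v huv
  by_cases hu : u ∈ B
  · have hvS := h u v huv hu
    have := hfn v fun hv => hBS v hv hvS
    have := hfS v hvS
    have := hfB u hu
    omega
  · by_cases hv : v ∈ B
    · have huS := h v u huv.symm hv
      have := hfn u hu
      have := hfS u huS
      have := hfB v hv
      omega
    · have := hfn u hu
      have := hfn v hv
      omega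

theorem isContained_graphK' (hV : Fintype.card V = n) {x : ℕ} {B : Finset V} {c : V}
    (hB : #B = x) (hc : c ∉ B) (h : ∀ u v, G.Adj u v → u ∈ B → v ∈ B ∨ v = c) :
    G.IsContained (graphK' n x) := by
  refine isContained_of_prefix (R := fun u v => (x ≤ u ∧ x ≤ v) ∨ (u ≤ x ∧ v ≤ x))
    hV (pre := B.toList ++ [c]) ?_ ?_
  · rw [List.nodup_append]
    refine ⟨Finset.nodup_toList _, by simp, ?_⟩
    rintro u hu v hv rfl
    simp at hu hv
    exact hc (hv ▸ hu)
  intro f h1 h2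
  have hfB : ∀ v ∈ B, f v < x := by
    intro v hv
    rw [h1 v (by simp [hv]), ← hB]
    exact idxOf_toList_append.1 hv
  have hfc : f c = x := by
    rw [h1 c (by simp), idxOf_toList_append.2 hc]
    simp [hB]
  have hfn : ∀ v, v ∉ B → x ≤ f v := by
    intro v hv
    by_cases hvc : v = c
    · rw [hvc, hfc]
    · have := h2 v (by simp [hv, hvc])
      simp at this
      omega
  have hle : ∀ v, v ∈ B ∨ v = c → f v ≤ x := by
    rintro v (hv | rfl)
    · exact (hfB v hv).le
    · exact hfc.le
  intro u v huv
  by_cases hu : u ∈ B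
  · have := hle v (h u v huv hu)
    have := hfB u hu
    omega
  · by_cases hv : v ∈ B
    · have := hle u (h v u huv.symm hv)
      have := hfB v hv
      omega
    · have := hfn u hu
      have := hfn v hv
      omega

theorem isContained_graphH' (hV : Fintype.card V = n) {x : ℕ} {B S : Finset V} {b c : V}
    (hb : b ∈ B) (hc : c ∈ B) (hbc : b ≠ c) (hB : #B = x + 1)
    (hS : #S = x) (hBS : ∀ v ∈ B, v ∉ S)
    (h : ∀ u v, G.Adj u v → u ∈ B → v ∈ S ∨ (u = b ∧ v = c) ∨ (u = c ∧ v = b)) :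
    G.IsContained (graphH' n x) := by
  have hB1 : #((B.erase b).erase c) + 1 = x := by
    rw [Finset.card_erase_of_mem (by simp [hc, hbc.symm]), Finset.card_erase_of_mem hb]
    have := Finset.one_lt_card.2 ⟨b, hb, c, hc, hbc⟩
    omega
  set B' := (B.erase b).erase c with hB'
  have hBmem : ∀ v, v ∈ B ↔ v = b ∨ v = c ∨ v ∈ B' := by
    intro v
    simp only [hB', Finset.mem_erase]
    constructor
    · tauto
    · rintro (rfl | rfl | h)
      · exact hb
      · exact hc
      · exact h.2.2
  have hbB' : b ∉ B' := by simp [hB']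
  have hcB' : c ∉ B' := by simp [hB']
  refine isContained_of_prefix (R := fun u v => (x < u ∧ x < v) ∨ (u ≤ x ∧ x < v ∧ v ≤ 2 * x) ∨
    (u = 0 ∧ v = 1)) hV (pre := b :: c :: (B'.toList ++ S.toList)) ?_ ?_
  · rw [List.nodup_cons, List.nodup_cons, List.nodup_append]
    refine ⟨by simp [hbc, hbB', hBS b hb], by simp [hcB', hBS c hc], Finset.nodup_toList _,
      Finset.nodup_toList _, ?_⟩
    rintro u hu v hv rfl
    rw [Finset.mem_toList] at hu hv
    exact hBS u ((hBmem u).2 (Or.inr (Or.inr hu))) hv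
  intro f h1 h2
  have hfb : f b = 0 := by rw [h1 b (by simp)]; simp
  have hfc : f c = 1 := by
    rw [h1 c (by simp), List.idxOf_cons_ne _ hbc, List.idxOf_cons_self]
  have hidx : ∀ v, v ≠ b → v ≠ c → (b :: c :: (B'.toList ++ S.toList)).idxOf v =
      (B'.toList ++ S.toList).idxOf v + 2 := by
    intro v hvb hvc
    rw [List.idxOf_cons_ne _ hvb.symm, List.idxOf_cons_ne _ hvc.symm]
  have hfB : ∀ v ∈ B, f v ≤ x := by
    intro v hv
    rcases (hBmem v).1 hv with rfl | rfl | hv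
    · omega
    · omega
    · rw [h1 v (by simp [hv]), hidx v (fun h => hbB' (h ▸ hv)) (fun h => hcB' (h ▸ hv))]
      have := (idxOf_toList_append (l := S.toList)).1 hv
      omega
  have hfS : ∀ v ∈ S, f v = x + 1 + S.toList.idxOf v := by
    intro v hv
    have hvB : v ∉ B := fun h => hBS v h hv
    rw [hBmem] at hvB
    push Not at hvB
    rw [h1 v (by simp [hv]), hidx v hvB.1 hvB.2.1, idxOf_toList_append.2 hvB.2.2]
    omega
  have hfS' : ∀ v ∈ S, f v ≤ 2 * x := by
    intro v hv
    rw [hfS v hv]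
    have : S.toList.idxOf v < S.toList.length := List.idxOf_lt_length_iff.2 (by simpa using hv)
    rw [Finset.length_toList] at this
    omega
  have hfn : ∀ v, v ∉ B → x < f v := by
    intro v hv
    by_cases hvS : v ∈ S
    · rw [hfS v hvS]
      omega
    · rw [hBmem] at hv
      push Not at hv
      have := h2 v (by simp [hv, hvS])
      simp at this
      omega
  have key : ∀ u v, G.Adj u v → u ∈ B → (f u ≤ x ∧ x < f v ∧ f v ≤ 2 * x) ∨
      (f u = 0 ∧ f v = 1) ∨ (f v = 0 ∧ f u = 1) := by
    intro u v huv hu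
    rcases h u v huv hu with hv | ⟨rfl, rfl⟩ | ⟨rfl, rfl⟩
    · exact Or.inl ⟨hfB u hu, hfn v fun hvB => hBS v hvB hv, hfS' v hv⟩
    · exact Or.inr (Or.inl ⟨hfb, hfc⟩)
    · exact Or.inr (Or.inr ⟨hfb, hfc⟩)
  intro u v huv
  by_cases hu : u ∈ B
  · have := key u v huv hu
    omega
  · by_cases hv : v ∈ B
    · have := key v u huv.symm hv
      omega
    · exact Or.inl (Or.inl ⟨hfn u hu, hfn v hv⟩)

theorem isContained_graphG' (hV : Fintype.card V = n) {b c e x p q r : V}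
    (hnd : [b, c, e, x, p, q, r].Nodup)
    (hb : ∀ v, G.Adj b v → v = x ∨ v = p) (hc : ∀ v, G.Adj c v → v = x ∨ v = q)
    (he : ∀ v, G.Adj e v → v = x ∨ v = r) :
    G.IsContained (graphG' n) := by
  refine isContained_of_prefix (R := fun u v => (3 ≤ u ∧ 3 ≤ v) ∨ (u < 3 ∧ (v = 3 ∨ v = u + 4)))
    hV hnd ?_
  intro f h1 h2
  simp only [List.nodup_cons, List.mem_cons, List.not_mem_nil, not_or, or_false] at hnd
  have fb : f b = 0 := by rw [h1 b (by simp)]; simp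
  have fc : f c = 1 := by rw [h1 c (by simp)]; simp [hnd]
  have fe : f e = 2 := by rw [h1 e (by simp)]; simp [hnd]
  have fx : f x = 3 := by rw [h1 x (by simp)]; simp [hnd]
  have fp : f p = 4 := by rw [h1 p (by simp)]; simp [hnd]
  have fq : f q = 5 := by rw [h1 q (by simp)]; simp [hnd]
  have fr : f r = 6 := by rw [h1 r (by simp)]; simp [hnd]
  have hlow : ∀ v, v ≠ b → v ≠ c → v ≠ e → 3 ≤ f v := by
    intro v h3 h4 h5
    by_cases hv : v ∈ [b, c, e, x, p, q, r]
    · simp only [List.mem_cons, List.not_mem_nil, or_false] at hv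
      rcases hv with rfl | rfl | rfl | rfl | rfl | rfl | rfl
      all_goals first | omega | contradiction
    · have := h2 v hv
      simp at this
      omega
  have key : ∀ u v, G.Adj u v → (u = b ∨ u = c ∨ u = e) →
      f u < 3 ∧ (f v = 3 ∨ f v = f u + 4) := by
    rintro u v huv (rfl | rfl | rfl)
    · rcases hb v huv with rfl | rfl <;> omega
    · rcases hc v huv with rfl | rfl <;> omega
    · rcases he v huv with rfl | rfl <;> omega
  intro u v huv
  by_cases hu : u = b ∨ u = c ∨ u = e
  · exact Or.inl (Or.inr (key u v huv hu))
  · by_cases hv : v = b ∨ v = c ∨ v = e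
    · exact Or.inr (Or.inr (key v u huv.symm hv))
    · push Not at hu hv
      exact Or.inl (Or.inl ⟨hlow u hu.1 hu.2.1 hu.2.2, hlow v hv.1 hv.2.1 hv.2.2⟩)

theorem isContained_graphF (hV : Fintype.card V = n) {b c e g x y : V}
    (hnd : [b, c, e, g, x, y].Nodup)
    (hb : ∀ v, G.Adj b v → v = x ∨ v = y ∨ v = c) (hc : ∀ v, G.Adj c v → v = x ∨ v = y ∨ v = b)
    (he : ∀ v, G.Adj e v → v = x ∨ v = y ∨ v = g) (hg : ∀ v, G.Adj g v → v = x ∨ v = y ∨ v = e) :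
    G.IsContained (graphF n) := by
  refine isContained_of_prefix (R := fun u v => (4 ≤ u ∧ 4 ≤ v) ∨ (u < 4 ∧ (v = 4 ∨ v = 5)) ∨
    (u = 0 ∧ v = 1) ∨ (u = 2 ∧ v = 3)) hV hnd ?_
  intro f h1 h2
  simp only [List.nodup_cons, List.mem_cons, List.not_mem_nil, not_or, or_false] at hnd
  have fb : f b = 0 := by rw [h1 b (by simp)]; simp
  have fc : f c = 1 := by rw [h1 c (by simp)]; simp [hnd]
  have fe : f e = 2 := by rw [h1 e (by simp)]; simp [hnd]
  have fg : f g = 3 := by rw [h1 g (by simp)]; simp [hnd]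
  have fx : f x = 4 := by rw [h1 x (by simp)]; simp [hnd]
  have fy : f y = 5 := by rw [h1 y (by simp)]; simp [hnd]
  have hlow : ∀ v, ¬ (v = b ∨ v = c ∨ v = e ∨ v = g) → 4 ≤ f v := by
    intro v h3
    by_cases hv : v ∈ [b, c, e, g, x, y]
    · simp only [List.mem_cons, List.not_mem_nil, or_false] at hv
      rcases hv with rfl | rfl | rfl | rfl | rfl | rfl
      all_goals first | omega | simp at h3
    · have := h2 v hv
      simp at this
      omega
  have key : ∀ u v, G.Adj u v → (u = b ∨ u = c ∨ u = e ∨ u = g) →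
      (f u < 4 ∧ (f v = 4 ∨ f v = 5)) ∨ (f u = 0 ∧ f v = 1) ∨ (f v = 0 ∧ f u = 1) ∨
        (f u = 2 ∧ f v = 3) ∨ (f v = 2 ∧ f u = 3) := by
    rintro u v huv (rfl | rfl | rfl | rfl)
    · rcases hb v huv with rfl | rfl | rfl <;> omega
    · rcases hc v huv with rfl | rfl | rfl <;> omega
    · rcases he v huv with rfl | rfl | rfl <;> omega
    · rcases hg v huv with rfl | rfl | rfl <;> omega
  intro u v huv
  by_cases hu : u = b ∨ u = c ∨ u = e ∨ u = g
  · have := key u v huv hu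
    omega
  · by_cases hv : v = b ∨ v = c ∨ v = e ∨ v = g
    · have := key v u huv.symm hv
      omega
    · exact Or.inl (Or.inl ⟨hlow u hu, hlow v hv⟩)

end Embeddings

/-! ### The attachment of the low-degree set to the clique. -/

section Core
variable {V : Type*} [Fintype V]

/-- A maximal nonhamiltonian graph in which the vertices outside the small set `D` form a clique. -/
structure Core (G : SimpleGraph V) (D : Finset V) : Prop where
  sat : Sat G
  adj : ∀ u v, u ∉ D → v ∉ D → u ≠ v → G.Adj u v
  card : 2 * #D + 3 ≤ Fintype.card V

/-- The vertices outside `D` adjacent to all of `D`. -/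
noncomputable def hub (G : SimpleGraph V) (D : Finset V) : Finset V :=
  {a | a ∉ D ∧ ∀ b ∈ D, G.Adj a b}

/-- The neighbours of `b` that lie neither in `D` nor in the hub. -/
noncomputable def priv (G : SimpleGraph V) (D : Finset V) (b : V) : Finset V :=
  {a | a ∉ D ∧ a ∉ hub G D ∧ G.Adj a b}

/-- The neighbours of `b` in `D`. -/
noncomputable def inner (G : SimpleGraph V) (D : Finset V) (b : V) : Finset V :=
  {a | a ∈ D ∧ G.Adj a b}

variable {G : SimpleGraph V} {D : Finset V}

theorem mem_hub {a : V} : a ∈ hub G D ↔ a ∉ D ∧ ∀ b ∈ D, G.Adj a b := by simp [hub]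

theorem mem_priv {a b : V} : a ∈ priv G D b ↔ a ∉ D ∧ a ∉ hub G D ∧ G.Adj a b := by simp [priv]

theorem mem_inner {a b : V} : a ∈ inner G D b ↔ a ∈ D ∧ G.Adj a b := by simp [inner]

theorem neighborFinset_sdiff {b : V} (hb : b ∈ D) :
    G.neighborFinset b \ (univ \ (D ∪ hub G D)) = inner G D b ∪ hub G D := by
  ext x
  simp only [Finset.mem_sdiff, mem_neighborFinset, Finset.mem_univ, true_and, Finset.mem_union,
    mem_inner, not_not]
  constructor
  · rintro ⟨h1, h2 | h2⟩
    · exact Or.inl ⟨h2, h1.symm⟩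
    · exact Or.inr h2
  · rintro (h | h)
    · exact ⟨h.2.symm, Or.inl h.1⟩
    · exact ⟨((mem_hub.1 h).2 b hb).symm, Or.inr h⟩

theorem disjoint_inner_hub (b : V) : Disjoint (inner G D b) (hub G D) :=
  Finset.disjoint_left.2 fun _ hx hx2 => (mem_hub.1 hx2).1 (mem_inner.1 hx).1

theorem degree_eq_add {b : V} (hb : b ∈ D) :
    G.degree b = #(inner G D b) + #(hub G D) + #(priv G D b) := by
  rw [← Finset.card_union_of_disjoint (disjoint_inner_hub b), ← neighborFinset_sdiff hb,
    ← card_neighborFinset_eq_degree,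
    ← Finset.card_sdiff_add_card_inter (G.neighborFinset b) (univ \ (D ∪ hub G D))]
  congr 2
  ext x
  simp only [Finset.mem_inter, mem_neighborFinset, Finset.mem_sdiff, Finset.mem_univ, true_and,
    Finset.mem_union, not_or, mem_priv]
  constructor
  · exact fun h => ⟨h.2.1, h.2.2, h.1.symm⟩
  · exact fun h => ⟨h.2.2.symm, h.1, h.2.1⟩

theorem card_inner_lt {b : V} (hb : b ∈ D) : #(inner G D b) < #D := by
  refine Finset.card_lt_card ⟨fun x hx => (mem_inner.1 hx).1, fun h => ?_⟩
  exact (mem_inner.1 (h hb)).2.ne rfl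

/-- Ore's bound for `a` and `b`: the vertex `a` is adjacent to every other vertex outside `D` and,
in addition, to `T`. -/
theorem Core.card_add_degree_le (hC : Core G D) {a b : V} {T : Finset V} (ha : a ∉ D)
    (hT : ∀ x ∈ T, x ∈ D ∧ G.Adj a x) (hb : b ∈ D) (hab : ¬ G.Adj a b) :
    #T + G.degree b ≤ #D := by
  have hne : a ≠ b := fun h => ha (h ▸ hb)
  have hcard := hC.card
  have h1 := hC.sat.degree_add_le (by omega) hne hab
  have h2 : (univ \ insert a D) ∪ T ⊆ G.neighborFinset a := by
    intro x hx
    rw [mem_neighborFinset]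
    simp only [Finset.mem_union, Finset.mem_sdiff, Finset.mem_univ, true_and, Finset.mem_insert,
      not_or] at hx
    rcases hx with h | h
    · exact hC.adj a x ha h.2 (Ne.symm h.1)
    · exact (hT x h).2
  have h3 := Finset.card_le_card h2
  rw [Finset.card_union_of_disjoint, Finset.card_sdiff_of_subset (Finset.subset_univ _),
    Finset.card_insert_of_notMem ha, Finset.card_univ, card_neighborFinset_eq_degree] at h3
  · omega
  · rw [Finset.disjoint_left]
    intro x hx hxT
    simp only [Finset.mem_sdiff, Finset.mem_univ, true_and, Finset.mem_insert, not_or] at hx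
    exact hx.2 (hT x hxT).1

/-- A vertex outside the hub misses some `e ∈ D`. With two neighbours in `D` it would force `deg e ≤
#D - 2`. -/
theorem Core.eq_of_mem_priv (hC : Core G D) (hdeg : ∀ b ∈ D, #D ≤ G.degree b + 1) {a b c : V}
    (ha : a ∈ priv G D b) (hb : b ∈ D) (hc : c ∈ D) (hac : G.Adj a c) : b = c := by
  rw [mem_priv, mem_hub] at ha
  by_contra hbc
  obtain ⟨e, he, hae⟩ : ∃ e ∈ D, ¬ G.Adj a e := by
    by_contra h
    push Not at h
    exact ha.2.1 ⟨ha.1, h⟩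
  have := hC.card_add_degree_le (T := {b, c}) ha.1 (by
    intro x hx
    simp only [Finset.mem_insert, Finset.mem_singleton] at hx
    rcases hx with rfl | rfl
    · exact ⟨hb, ha.2.2⟩
    · exact ⟨hc, hac⟩) he hae
  rw [Finset.card_pair hbc] at this
  have := hdeg e he
  omega

/-- On a chord-free spanning path from `a` to `c`, the successor of any `p ∈ priv c` lies in `D`,
since otherwise it would be adjacent to `a` and the chords would cross. As `p` has no neighbour in
`D` but `c`, it must be the predecessor of `c`. -/
theorem Core.card_priv_le_one (hC : Core G D) (hdeg : ∀ b ∈ D, #D ≤ G.degree b + 1) {a b c : V}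
    (ha : a ∈ priv G D b) (hb : b ∈ D) (hc : c ∈ D) (hbc : b ≠ c) : #(priv G D c) ≤ 1 := by
  have hac : ¬ G.Adj a c := fun h => hbc (hC.eq_of_mem_priv hdeg ha hb hc h)
  have haD := (mem_priv.1 ha).1
  have hne : a ≠ c := fun h => haD (h ▸ hc)
  have hcard := hC.card
  obtain ⟨σ, h1, h2⟩ := hC.sat.exists_perm (by omega) hne hac
  have key : ∀ p ∈ priv G D c, p = σ.symm c := by
    intro p hp
    have hp' := mem_priv.1 hp
    have hpc : p ≠ c := hp'.2.2.ne
    obtain ⟨h3, h4⟩ := h2 p hpc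
    rw [Equiv.eq_symm_apply]
    by_cases hσ : σ p ∈ D
    · exact (hC.eq_of_mem_priv hdeg hp hc hσ h3).symm
    · exfalso
      refine h4 ⟨hC.adj a _ haD hσ ?_, hp'.2.2⟩
      intro h
      exact hpc (σ.injective (h.symm.trans h1.symm))
  exact Finset.card_le_one.2 fun p hp q hq => (key p hp).trans (key q hq).symm

/-- The vertices of `D` with a neighbour outside `D` and the hub. -/
noncomputable def attached (G : SimpleGraph V) (D : Finset V) : Finset V :=
  {b | b ∈ D ∧ (priv G D b).Nonempty}

theorem mem_attached {b : V} : b ∈ attached G D ↔ b ∈ D ∧ (priv G D b).Nonempty := by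
  simp [attached]

/-- The degree after collapsing everything outside `D` and the hub. -/
noncomputable def coreDegree (G : SimpleGraph V) (D : Finset V) (b : V) : ℕ :=
  #(inner G D b) + #(hub G D) + if b ∈ attached G D then 1 else 0

/-- Contract everything outside `D` and the hub. The result has `#D + #hub + 1` vertices, hub
vertices are adjacent to all others, and the contracted vertex sees the hub and the attached
vertices. Distinct vertices of `D` share no private neighbour, so the contraction can be undone. -/
theorem Core.false_of_coreDegree (hC : Core G D)
    (hpriv : ∀ a b c, a ∈ priv G D b → b ∈ D → c ∈ D → G.Adj a c → b = c)
    (hhub : #(hub G D) ≤ #D) (b : V)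
    (h2 : 2 ≤ #(hub G D) + #(attached G D))
    (h : ∀ v ∈ D, #D + #(hub G D) + 1 ≤ 2 * coreDegree G D v ∨ (v = b ∧ 3 ≤ coreDegree G D v)) :
    False := by
  set T := univ \ (D ∪ hub G D) with hT
  have hdis : Disjoint D (hub G D) :=
    Finset.disjoint_left.2 fun x hx hx2 => (mem_hub.1 hx2).1 hx
  have hcard := hC.card
  have hTc : #T + (#D + #(hub G D)) = Fintype.card V := by
    rw [← Finset.card_union_of_disjoint hdis, ← Finset.card_univ]
    exact Finset.card_sdiff_add_card_eq_card (Finset.subset_univ _)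
  have hTmem : ∀ a, a ∈ T ↔ a ∉ D ∧ a ∉ hub G D := by
    intro a
    simp [hT]
  have hTn : ∀ a, a ∉ T → a ∈ D ∨ a ∈ hub G D := by
    intro a ha
    rw [hTmem] at ha
    tauto
  have hadjhub : ∀ p ∈ hub G D, ∀ a, a ≠ p → G.Adj a p := by
    intro p hp a hap
    rw [mem_hub] at hp
    by_cases ha : a ∈ D
    · exact (hp.2 a ha).symm
    · exact hC.adj a p ha hp.1 hap
  have hThub : ∀ p ∈ hub G D, ∀ a ∈ T, G.Adj a p := fun p hp a ha =>
    hadjhub p hp a fun h => ((hTmem a).1 ha).2 (h ▸ hp)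
  have hTpriv : ∀ p, (∃ a ∈ T, G.Adj a p) ↔ (priv G D p).Nonempty := by
    intro p
    constructor
    · rintro ⟨a, ha, hap⟩
      rw [hTmem] at ha
      exact ⟨a, mem_priv.2 ⟨ha.1, ha.2, hap⟩⟩
    · rintro ⟨a, ha⟩
      rw [mem_priv] at ha
      exact ⟨a, (hTmem a).2 ⟨ha.1, ha.2.1⟩, ha.2.2⟩
  have hother : ∀ a, ∃ a' ∈ T, a' ≠ a := by
    intro a
    exact Finset.exists_mem_ne (by omega) a
  refine hC.sat.1 (ham_of_collapseDegree (T := T) b ?_ ?_ ?_ ?_)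
  · intro u hu v hv
    exact hC.adj u v ((hTmem u).1 hu).1 ((hTmem v).1 hv).1
  · rintro p q hp hq hpq ⟨a, ha, hap⟩ ⟨a', ha', haq⟩
    rcases hTn p hp with hp | hp
    · rcases hTn q hq with hq | hq
      · refine ⟨a, ha, a', ha', ?_, hap, haq⟩
        rintro rfl
        exact hpq (hpriv a p q (mem_priv.2 ⟨((hTmem a).1 ha).1, ((hTmem a).1 ha).2, hap⟩) hp hq haq)
      · obtain ⟨a'', h3, h4⟩ := hother a
        exact ⟨a, ha, a'', h3, h4.symm, hap, hThub q hq _ h3⟩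
    · obtain ⟨a'', h3, h4⟩ := hother a'
      exact ⟨a'', h3, a', ha', h4, hThub p hp _ h3, haq⟩
  · refine h2.trans ?_
    rw [← Finset.card_union_of_disjoint]
    · refine Finset.card_le_card fun v hv => ?_
      simp only [Finset.mem_filter, Finset.mem_univ, true_and]
      rcases Finset.mem_union.1 hv with h | h
      · obtain ⟨a, ha, _⟩ := hother v
        exact ⟨fun hvT => ((hTmem v).1 hvT).2 h, a, ha, hThub v h a ha⟩
      · rw [mem_attached] at h
        exact ⟨fun hvT => ((hTmem v).1 hvT).1 h.1, (hTpriv v).2 h.2⟩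
    · exact Finset.disjoint_left.2 fun x hx hx2 => (mem_hub.1 hx).1 (mem_attached.1 hx2).1
  · intro v hv
    rcases hTn v hv with hv | hv
    · have : collapseDegree G T v = coreDegree G D v := by
        unfold collapseDegree coreDegree
        rw [hT, neighborFinset_sdiff hv, Finset.card_union_of_disjoint (disjoint_inner_hub v),
          ← hT]
        congr 1
        simp only [hTpriv, mem_attached, hv, true_and]
      rw [this]
      rcases h v hv with h | h
      · left; omega
      · exact Or.inr h
    · left
      have h1 : (D ∪ hub G D).erase v ⊆ G.neighborFinset v \ T := by
        intro x hx
        rw [Finset.mem_erase] at hx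
        rw [Finset.mem_sdiff, mem_neighborFinset]
        exact ⟨(hadjhub v hv x hx.1).symm, fun hxT => (Finset.mem_sdiff.1 hxT).2 hx.2⟩
      have h3 := Finset.card_le_card h1
      rw [Finset.card_erase_of_mem (Finset.mem_union_right _ hv),
        Finset.card_union_of_disjoint hdis] at h3
      have h5 : ∃ a ∈ T, G.Adj a v := by
        obtain ⟨a, ha, _⟩ := hother v
        exact ⟨a, ha, hThub v hv a ha⟩
      have h4 := Finset.card_pos.2 ⟨v, hv⟩
      unfold collapseDegree
      rw [if_pos h5]
      have : 0 < #D ∨ #D = 0 := by omega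
      omega

theorem adj_cases (D : Finset V) {u v : V} (huv : G.Adj u v) :
    v ∈ inner G D u ∨ v ∈ hub G D ∨ v ∈ priv G D u := by
  by_cases h1 : v ∈ D
  · exact Or.inl (mem_inner.2 ⟨h1, huv.symm⟩)
  · by_cases h2 : v ∈ hub G D
    · exact Or.inr (Or.inl h2)
    · exact Or.inr (Or.inr (mem_priv.2 ⟨h1, h2, huv.symm⟩))

theorem Core.isContained_of_card_eq (hC : Core G D) {n d : ℕ} (hV : Fintype.card V = n)
    (hd : 1 ≤ d) (hD : #D = d) (hdeg : ∀ b ∈ D, G.degree b = d) :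
    G.IsContained (graphH n d) ∨ G.IsContained (graphK' n d) := by
  have hpriv : ∀ b ∈ D, priv G D b = ∅ := by
    intro b hb
    rw [Finset.eq_empty_iff_forall_notMem]
    intro a ha
    rw [mem_priv, mem_hub] at ha
    refine ha.2.1 ⟨ha.1, fun c hc => ?_⟩
    by_contra hac
    have := hC.card_add_degree_le (T := {b}) ha.1 (by simp [hb, ha.2.2]) hc hac
    rw [Finset.card_singleton, hdeg c hc] at this
    omega
  have hsum : ∀ b ∈ D, #(inner G D b) + #(hub G D) = d := by
    intro b hb
    have := degree_eq_add (G := G) hb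
    rw [hpriv b hb, hdeg b hb] at this
    simp at this
    omega
  obtain ⟨b₀, hb₀⟩ : D.Nonempty := Finset.card_pos.1 (by omega)
  have h1 := hsum b₀ hb₀
  have h2 := card_inner_lt (G := G) hb₀
  have hcases : ∀ u v, G.Adj u v → u ∈ D → v ∈ inner G D u ∨ v ∈ hub G D := by
    intro u v huv hu
    have := adj_cases D huv
    rw [hpriv u hu] at this
    simpa using this
  rcases Nat.lt_or_ge (#(hub G D)) 2 with hs | hs
  · right
    obtain ⟨c, hc⟩ := Finset.card_eq_one.1 (show #(hub G D) = 1 by omega)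
    have hcD : c ∉ D := (mem_hub.1 (hc ▸ Finset.mem_singleton_self c)).1
    refine isContained_graphK' hV hD hcD fun u v huv hu => ?_
    rcases hcases u v huv hu with h | h
    · exact Or.inl (mem_inner.1 h).1
    · rw [hc] at h
      exact Or.inr (by simpa using h)
  rcases Nat.lt_or_ge (#(hub G D)) d with hs' | hs'
  · exfalso
    -- Every vertex of `D` keeps degree `d` in a contracted graph of order `d + #hub + 1 ≤ 2 * d`.
    refine hC.false_of_coreDegree (fun a b c ha hb => ?_) (by omega) b₀ (by omega) fun v hv => ?_
    · rw [hpriv b hb] at ha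
      simp at ha
    · left
      have := hsum v hv
      unfold coreDegree
      split_ifs <;> omega
  · left
    refine isContained_graphH hV hD (S := hub G D) (by omega)
      (fun v hv h => (mem_hub.1 h).1 hv) fun u v huv hu => ?_
    rcases hcases u v huv hu with h | h
    · have := hsum u hu
      have := Finset.card_pos.2 ⟨v, h⟩
      omega
    · exact h

/-- By `hcount`, the two prescribed paths need an excess of vertices of `D` over hub vertices of at
least `#D - #hub`. Excess is gained by edges inside `D` and by private neighbours standing in for
hub vertices. -/
theorem Core.false_of_weave (hC : Core G D) {X₁ X₂ : List V} {a x y w : V}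
    (h₁ : X₁.IsChain G.Adj) (h₂ : X₂.IsChain G.Adj) (hnd : (X₁ ++ X₂).Nodup)
    (ha : X₁.head? = some a) (haS : a ∈ hub G D) (hx : X₁.getLast? = some x) (hxD : x ∉ D)
    (hy : X₂.head? = some y) (hyD : y ∉ D) (hw : X₂.getLast? = some w) (hwD : w ∈ D)
    (hcount : #D + (X₁ ++ X₂).countP (· ∈ hub G D) ≤
      #(hub G D) + (X₁ ++ X₂).countP (· ∈ D)) : False :=
  hC.sat.1 (ham_of_weave hC.adj (fun _ h => (mem_hub.1 h).1) (fun _ h => (mem_hub.1 h).2)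
    h₁ h₂ hnd ha haS hx hxD hy hyD hw hwD hcount)

end Core

/-! ### Classification when no vertex of `D` has a private neighbour. -/

section Main
variable {V : Type*} {G : SimpleGraph V} {D : Finset V} {n d : ℕ}

/-- The possible conclusions of the classification. -/
def Classified (G : SimpleGraph V) (n d : ℕ) : Prop :=
  (d = 2 ∧ G.IsContained (graphG' n)) ∨ (d = 3 ∧ G.IsContained (graphF n)) ∨
    ∃ H ∈ family n d, G.IsContained H

theorem Classified.of_graphH (h : G.IsContained (graphH n d)) : Classified G n d :=
  Or.inr (Or.inr ⟨_, by simp [family], h⟩)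

theorem Classified.of_graphH_succ (h : G.IsContained (graphH n (d + 1))) : Classified G n d :=
  Or.inr (Or.inr ⟨_, by simp [family], h⟩)

theorem Classified.of_graphK' (h : G.IsContained (graphK' n d)) : Classified G n d :=
  Or.inr (Or.inr ⟨_, by simp [family], h⟩)

theorem Classified.of_graphK'_succ (h : G.IsContained (graphK' n (d + 1))) : Classified G n d :=
  Or.inr (Or.inr ⟨_, by simp [family], h⟩)

theorem Classified.of_graphH' (h : G.IsContained (graphH' n d)) : Classified G n d :=
  Or.inr (Or.inr ⟨_, by simp [family], h⟩)

theorem Classified.mono {H : SimpleGraph V} (hle : G ≤ H) (h : Classified H n d) :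
    Classified G n d := by
  rcases h with ⟨h1, h⟩ | ⟨h1, h⟩ | ⟨K, hK, h⟩
  · exact Or.inl ⟨h1, h.mono_left hle⟩
  · exact Or.inr (Or.inl ⟨h1, h.mono_left hle⟩)
  · exact Or.inr (Or.inr ⟨K, hK, h.mono_left hle⟩)

theorem exists_ne_of_card_lt {S : Finset V} (l : List V) (h : l.length < #S) :
    ∃ x ∈ S, x ∉ l := by
  by_contra hc
  push Not at hc
  have : S ⊆ l.toFinset := fun x hx => List.mem_toFinset.2 (hc x hx)
  have := (Finset.card_le_card this).trans (List.toFinset_card_le l)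
  omega

variable [Fintype V]

theorem notMem_hub {b : V} (hb : b ∈ D) : b ∉ hub G D := fun h => (mem_hub.1 h).1 hb

theorem notMem_of_mem_hub {a : V} (ha : a ∈ hub G D) : a ∉ D := (mem_hub.1 ha).1

theorem hub_adj {a b : V} (ha : a ∈ hub G D) (hb : b ∈ D) : G.Adj a b := (mem_hub.1 ha).2 b hb

theorem eq_of_card_inner_le_one {b c e : V} (h : #(inner G D b) ≤ 1) (hc : c ∈ D)
    (hbc : G.Adj b c) (he : e ∈ D) (hbe : G.Adj b e) : c = e :=
  Finset.card_le_one.1 h c (mem_inner.2 ⟨hc, hbc.symm⟩) e (mem_inner.2 ⟨he, hbe.symm⟩)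

/-- Here an excess of one is needed. The paths `p e f q` and `r b c` contain four vertices of `D`
and three of the hub. -/
theorem Core.false_of_disjoint_edges (hC : Core G D) (hs : #(hub G D) + 1 = #D) {b c e f : V}
    (hb : b ∈ D) (hc : c ∈ D) (he : e ∈ D) (hf : f ∈ D) (hbc : G.Adj b c) (hef : G.Adj e f)
    (hnd : [b, c, e, f].Nodup) : False := by
  have h4 : 4 ≤ #D := by
    rw [show 4 = ([b, c, e, f] : List V).toFinset.card by rw [List.toFinset_card_of_nodup hnd]; rfl]
    refine Finset.card_le_card fun x hx => ?_
    simp at hx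
    rcases hx with rfl | rfl | rfl | rfl <;> assumption
  obtain ⟨p, q, r, hp, hq, hr, hpq, hpr, hqr⟩ :=
    Finset.two_lt_card_iff.1 (show 2 < #(hub G D) by omega)
  have hp' := notMem_of_mem_hub hp
  have hq' := notMem_of_mem_hub hq
  have hr' := notMem_of_mem_hub hr
  refine hC.false_of_weave (X₁ := [p, e, f, q]) (X₂ := [r, b, c]) ?_ ?_ ?_ rfl hp rfl hq' rfl hr'
    rfl hc ?_
  · simp [hub_adj hp he, hef, (hub_adj hq hf).symm]
  · simp [hub_adj hr hb, hbc]
  · simp only [List.cons_append, List.nil_append, List.nodup_cons, List.mem_cons,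
      List.not_mem_nil, or_false, not_or, not_false_eq_true, List.nodup_nil, and_true] at hnd ⊢
    and_intros <;> grind
  · simp [hp, hq, hr, hp', hq', hr', hb, hc, he, hf, notMem_hub]
    omega

theorem Core.classified_of_hub_eq (hC : Core G D) (hV : Fintype.card V = n) (hd : 1 ≤ d)
    (hD : #D = d + 1) (hpriv : ∀ b ∈ D, priv G D b = ∅)
    (hin : ∀ b ∈ D, #(inner G D b) ≤ 1) (hs : #(hub G D) = d) : Classified G n d := by
  apply Classified.of_graphH'
  have hcases : ∀ u v, G.Adj u v → u ∈ D → v ∈ D ∨ v ∈ hub G D := by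
    intro u v huv hu
    have := adj_cases D huv
    rw [hpriv u hu, mem_inner] at this
    simp at this
    tauto
  by_cases hedge : ∃ b ∈ D, ∃ c ∈ D, G.Adj b c
  · obtain ⟨b, hb, c, hc, hbc⟩ := hedge
    refine isContained_graphH' hV hb hc hbc.ne hD hs (fun v hv => notMem_hub hv) fun u v huv hu => ?_
    rcases hcases u v huv hu with hv | hv
    · right
      by_cases hub : u = b
      · subst hub
        exact Or.inl ⟨rfl, eq_of_card_inner_le_one (hin u hu) hv huv hc hbc⟩
      by_cases huc : u = c
      · subst huc
        exact Or.inr ⟨rfl, eq_of_card_inner_le_one (hin u hu) hv huv hb hbc.symm⟩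
      exfalso
      have hvb : v ≠ b := by
        rintro rfl
        exact huc (eq_of_card_inner_le_one (hin v hv) hu huv.symm hc hbc)
      have hvc : v ≠ c := by
        rintro rfl
        exact hub (eq_of_card_inner_le_one (hin v hv) hu huv.symm hb hbc.symm)
      refine hC.false_of_disjoint_edges (by omega) hb hc hu hv hbc huv ?_
      have h1 := hbc.ne
      have h2 := huv.ne
      simp
      tauto
    · exact Or.inl hv
  · push Not at hedge
    obtain ⟨b, hb, c, hc, hbc⟩ := Finset.one_lt_card.1 (show 1 < #D by omega)
    refine isContained_graphH' hV hb hc hbc hD hs (fun v hv => notMem_hub hv) fun u v huv hu => ?_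
    rcases hcases u v huv hu with hv | hv
    · exact absurd huv (hedge u hu v hv)
    · exact Or.inl hv

/-- An excess of two is needed. A fourth vertex `g` has a neighbour in `D`: either this extends `e c
f` to a path on four vertices of `D`, or it gives an edge disjoint from `e c f`. Both suffice. -/
theorem Core.false_of_card_inner_eq_two (hC : Core G D) (hD3 : 4 ≤ #D)
    (hpos : ∀ b ∈ D, 1 ≤ #(inner G D b)) (hs : #(hub G D) + 2 = #D) {c : V} (hc : c ∈ D)
    (h2 : #(inner G D c) = 2) : False := by
  obtain ⟨e, f, hef, hcef⟩ := Finset.card_eq_two.1 h2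
  have he := mem_inner.1 (hcef ▸ Finset.mem_insert_self e {f})
  have hf := mem_inner.1 (hcef ▸ Finset.mem_insert_of_mem (Finset.mem_singleton_self f))
  have hinc : ∀ x ∈ D, G.Adj x c → x = e ∨ x = f := by
    intro x hx hxc
    have : x ∈ inner G D c := mem_inner.2 ⟨hx, hxc⟩
    rw [hcef] at this
    simpa using this
  obtain ⟨p, hp, q, hq, hpq⟩ := Finset.one_lt_card.1 (show 1 < #(hub G D) by omega)
  have hp' := notMem_of_mem_hub hp
  have hq' := notMem_of_mem_hub hq
  have hpath : ∀ g e f, g ∈ D → e ∈ D → f ∈ D → G.Adj g e → G.Adj e c → G.Adj c f →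
      [g, e, c, f].Nodup → False := by
    intro g e f hg he hf hge hec hcf hnd
    refine hC.false_of_weave (X₁ := [p]) (X₂ := [q, g, e, c, f]) ?_ ?_ ?_ rfl hp rfl hp' rfl hq'
      rfl hf ?_
    · simp
    · simp [hub_adj hq hg, hge, hec, hcf]
    · simp only [List.cons_append, List.nil_append, List.nodup_cons, List.mem_cons,
        List.not_mem_nil, or_false, not_or, not_false_eq_true, List.nodup_nil, and_true] at hnd ⊢
      and_intros <;> grind
    · simp [hp, hq, hp', hq', hg, hc, he, hf, notMem_hub]
      omega
  obtain ⟨g, hg, hgn⟩ := exists_ne_of_card_lt (S := D) [c, e, f] (by simp; omega)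
  simp only [List.mem_cons, List.not_mem_nil, or_false, not_or] at hgn
  obtain ⟨h, hh⟩ := Finset.card_pos.1 (hpos g hg)
  rw [mem_inner] at hh
  have hce := he.2.ne
  have hcf := hf.2.ne
  by_cases hhe : h = e
  · subst hhe
    refine hpath g h f hg hh.1 hf.1 hh.2.symm he.2 hf.2.symm ?_
    simp
    and_intros <;> grind
  by_cases hhf : h = f
  · subst hhf
    refine hpath g h e hg hh.1 he.1 hh.2.symm hf.2 he.2.symm ?_
    simp
    and_intros <;> grind
  have hhc : h ≠ c := by
    rintro rfl
    have := hinc g hg hh.2.symm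
    tauto
  have hgh := hh.2.ne
  have h5 : 5 ≤ #D := by
    by_contra h5
    have hnd : [c, e, f, g, h].Nodup := by
      simp
      and_intros <;> grind
    have h6 : ([c, e, f, g, h] : List V).toFinset.card ≤ #D := by
      refine Finset.card_le_card fun x hx => ?_
      simp at hx
      rcases hx with rfl | rfl | rfl | rfl | rfl
      exacts [hc, he.1, hf.1, hg, hh.1]
    rw [List.toFinset_card_of_nodup hnd] at h6
    simp at h6
    omega
  obtain ⟨r, hr, hrn⟩ := exists_ne_of_card_lt (S := hub G D) [p, q] (by simp; omega)
  simp only [List.mem_cons, List.not_mem_nil, or_false, not_or] at hrn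
  have hr' := notMem_of_mem_hub hr
  refine hC.false_of_weave (X₁ := [p, g, h, q]) (X₂ := [r, e, c, f]) ?_ ?_ ?_ rfl hp rfl hq' rfl hr'
    rfl hf.1 ?_
  · simp [hub_adj hp hg, hh.2.symm, (hub_adj hq hh.1).symm]
  · simp [hub_adj hr he.1, he.2, hf.2.symm]
  · simp only [List.cons_append, List.nil_append, List.nodup_cons, List.mem_cons,
      List.not_mem_nil, or_false, not_or, not_false_eq_true, List.nodup_nil, and_true]
    and_intros <;> grind
  · simp [hp, hq, hr, hp', hq', hr', hg, hh.1, hc, he.1, hf.1, notMem_hub]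
    omega

/-- `D` induces a perfect matching. Two matching edges and a hub of size two give `F`; three
matching edges give six vertices of `D` against four hub vertices, enough for a spanning cycle. -/
theorem Core.classified_of_perfect_matching (hC : Core G D) (hV : Fintype.card V = n) (hd : 3 ≤ d)
    (hD : #D = d + 1) (hpriv : ∀ b ∈ D, priv G D b = ∅)
    (hin : ∀ b ∈ D, #(inner G D b) = 1) (hs : #(hub G D) + 2 = #D) : Classified G n d := by
  obtain ⟨b, hb⟩ : D.Nonempty := Finset.card_pos.1 (by omega)
  have hex : ∀ b ∈ D, ∃ c ∈ D, G.Adj b c := by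
    intro b hb
    obtain ⟨c, hc⟩ := Finset.card_pos.1 (show 0 < #(inner G D b) by rw [hin b hb]; omega)
    rw [mem_inner] at hc
    exact ⟨c, hc.1, hc.2.symm⟩
  have huniq : ∀ b ∈ D, ∀ c ∈ D, ∀ e ∈ D, G.Adj b c → G.Adj b e → c = e := by
    intro b hb c hc e he hbc hbe
    exact eq_of_card_inner_le_one (hin b hb).le hc hbc he hbe
  obtain ⟨c, hc, hbc⟩ := hex b hb
  obtain ⟨e, he, hen⟩ := exists_ne_of_card_lt (S := D) [b, c] (by simp; omega)
  simp only [List.mem_cons, List.not_mem_nil, or_false, not_or] at hen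
  obtain ⟨f, hf, hef⟩ := hex e he
  have hfb : f ≠ b := by
    rintro rfl
    exact hen.2 (huniq f hf e he c hc hef.symm hbc)
  have hfc : f ≠ c := by
    rintro rfl
    exact hen.1 (huniq f hf e he b hb hef.symm hbc.symm)
  have h1 := hbc.ne
  have h2 := hef.ne
  rcases hd.eq_or_lt with hd | hd
  · subst hd
    refine Or.inr (Or.inl ⟨rfl, ?_⟩)
    obtain ⟨x, y, hxy, hhub⟩ := Finset.card_eq_two.1 (show #(hub G D) = 2 by omega)
    have hx := notMem_of_mem_hub (hhub ▸ Finset.mem_insert_self x {y} : x ∈ hub G D)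
    have hy := notMem_of_mem_hub
      (hhub ▸ Finset.mem_insert_of_mem (Finset.mem_singleton_self y) : y ∈ hub G D)
    have key : ∀ u ∈ D, ∀ w ∈ D, G.Adj u w → ∀ v, G.Adj u v → v = x ∨ v = y ∨ v = w := by
      intro u hu w hw huw v huv
      have := adj_cases D huv
      rw [hpriv u hu, mem_inner, hhub] at this
      simp at this
      rcases this with h | h
      · exact Or.inr (Or.inr (huniq u hu v h.1 w hw huv huw))
      · tauto
    refine isContained_graphF hV (b := b) (c := c) (e := e) (g := f) (x := x) (y := y) ?_
      (key b hb c hc hbc) (key c hc b hb hbc.symm) (key e he f hf hef) (key f hf e he hef.symm)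
    simp only [List.nodup_cons, List.mem_cons,
      List.not_mem_nil, or_false, not_or, not_false_eq_true, List.nodup_nil, and_true]
    and_intros <;> grind
  · exfalso
    obtain ⟨g, hg, hgn⟩ := exists_ne_of_card_lt (S := D) [b, c, e, f] (by simp; omega)
    simp only [List.mem_cons, List.not_mem_nil, or_false, not_or] at hgn
    obtain ⟨h, hh, hgh⟩ := hex g hg
    have hhb : h ≠ b := by
      rintro rfl
      exact hgn.2.1 (huniq h hh g hg c hc hgh.symm hbc)
    have hhc : h ≠ c := by
      rintro rfl
      exact hgn.1 (huniq h hh g hg b hb hgh.symm hbc.symm)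
    have hhe : h ≠ e := by
      rintro rfl
      exact hgn.2.2.2 (huniq h hh g hg f hf hgh.symm hef)
    have hhf : h ≠ f := by
      rintro rfl
      exact hgn.2.2.1 (huniq h hh g hg e he hgh.symm hef.symm)
    have h3 := hgh.ne
    have h6 : 6 ≤ #D := by
      have hnd : [b, c, e, f, g, h].Nodup := by
        simp only [List.nodup_cons, List.mem_cons,
          List.not_mem_nil, or_false, not_or, not_false_eq_true, List.nodup_nil, and_true]
        and_intros <;> grind
      have h6 : ([b, c, e, f, g, h] : List V).toFinset.card ≤ #D := by
        refine Finset.card_le_card fun x hx => ?_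
        simp at hx
        rcases hx with rfl | rfl | rfl | rfl | rfl | rfl <;> assumption
      rw [List.toFinset_card_of_nodup hnd] at h6
      simpa using h6
    obtain ⟨p, q, r, hp, hq, hr, hpq, hpr, hqr⟩ :=
      Finset.two_lt_card_iff.1 (show 2 < #(hub G D) by omega)
    obtain ⟨t, ht, htn⟩ := exists_ne_of_card_lt (S := hub G D) [p, q, r] (by simp; omega)
    simp only [List.mem_cons, List.not_mem_nil, or_false, not_or] at htn
    have hp' := notMem_of_mem_hub hp
    have hq' := notMem_of_mem_hub hq
    have hr' := notMem_of_mem_hub hr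
    have ht' := notMem_of_mem_hub ht
    refine hC.false_of_weave (X₁ := [p, b, c, q]) (X₂ := [r, e, f, t, g, h]) ?_ ?_ ?_ rfl hp rfl hq'
      rfl hr' rfl hh ?_
    · simp [hub_adj hp hb, hbc, (hub_adj hq hc).symm]
    · simp [hub_adj hr he, hef, (hub_adj ht hf).symm, hub_adj ht hg, hgh]
    · simp only [List.cons_append, List.nil_append, List.nodup_cons, List.mem_cons,
        List.not_mem_nil, or_false, not_or, not_false_eq_true, List.nodup_nil, and_true]
      and_intros <;> grind
    · simp [hp, hq, hr, ht, hp', hq', hr', ht', hb, hc, he, hf, hg, hh,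
        notMem_hub]
      omega

theorem Core.classified_of_attached_eq_empty (hC : Core G D) (hV : Fintype.card V = n)
    (hd : 1 ≤ d) (hD : #D = d + 1) (h1 : ∀ b ∈ D, d ≤ G.degree b)
    (h2 : ∀ b ∈ D, G.degree b ≤ d + 1) (hatt : attached G D = ∅) : Classified G n d := by
  have hpriv : ∀ b ∈ D, priv G D b = ∅ := by
    intro b hb
    by_contra hne
    have : b ∈ attached G D := mem_attached.2 ⟨hb, Finset.nonempty_iff_ne_empty.2 hne⟩
    simp [hatt] at this
  have hsum1 : ∀ b ∈ D, d ≤ #(inner G D b) + #(hub G D) := by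
    intro b hb
    have h3 := degree_eq_add (G := G) hb
    rw [hpriv b hb, Finset.card_empty] at h3
    have := h1 b hb
    omega
  have hsum2 : ∀ b ∈ D, #(inner G D b) + #(hub G D) ≤ d + 1 := by
    intro b hb
    have h3 := degree_eq_add (G := G) hb
    rw [hpriv b hb, Finset.card_empty] at h3
    have := h2 b hb
    omega
  have hcases : ∀ u v, G.Adj u v → u ∈ D → v ∈ inner G D u ∨ v ∈ hub G D := by
    intro u v huv hu
    have := adj_cases D huv
    rw [hpriv u hu] at this
    simpa using this
  obtain ⟨b, hb⟩ : D.Nonempty := Finset.card_pos.1 (by omega)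
  have hb2 := hsum2 b hb
  -- Without private neighbours, each vertex of `D` has `d` or `d + 1` neighbours in `D` and the hub
  -- together, so the size of the hub decides the case. For hub sizes from 2 to `d - 2` contraction
  -- applies.
  rcases (show #(hub G D) = 0 ∨ #(hub G D) = 1 ∨ (2 ≤ #(hub G D) ∧ #(hub G D) + 2 ≤ d) ∨
    (2 ≤ #(hub G D) ∧ #(hub G D) + 1 = d) ∨ #(hub G D) = d ∨ #(hub G D) = d + 1 by omega) with
    hs | hs | hs | hs | hs | hs
  · apply Classified.of_graphK'
    rw [Finset.card_eq_zero] at hs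
    refine isContained_graphK' hV (B := D.erase b) (c := b)
      (by rw [Finset.card_erase_of_mem hb]; omega) (by simp) fun u v huv hu => ?_
    have := hcases u v huv (Finset.mem_of_mem_erase hu)
    rw [hs, mem_inner] at this
    simp at this ⊢
    tauto
  · apply Classified.of_graphK'_succ
    obtain ⟨c, hc⟩ := Finset.card_eq_one.1 hs
    have hcD : c ∉ D := notMem_of_mem_hub (hc ▸ Finset.mem_singleton_self c : c ∈ hub G D)
    refine isContained_graphK' hV hD hcD fun u v huv hu => ?_
    have := hcases u v huv hu
    rw [hc, mem_inner] at this
    simp at this ⊢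
    tauto
  · exfalso
    refine hC.false_of_coreDegree (fun x y z hx hy => ?_) (by omega) b (by omega) fun v hv => ?_
    · rw [hpriv y hy] at hx
      simp at hx
    · left
      have := hsum1 v hv
      unfold coreDegree
      split_ifs <;> omega
  · by_cases htwo : ∃ c ∈ D, #(inner G D c) = 2
    · obtain ⟨c, hc, h2⟩ := htwo
      exact (hC.false_of_card_inner_eq_two (by omega)
        (fun b hb => by have := hsum1 b hb; omega) (by omega) hc h2).elim
    · push Not at htwo
      refine hC.classified_of_perfect_matching hV (by omega) hD hpriv (fun b hb => ?_) (by omega)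
      have := hsum1 b hb
      have := hsum2 b hb
      have := htwo b hb
      omega
  · exact hC.classified_of_hub_eq hV hd hD hpriv (fun b hb => by have := hsum2 b hb; omega) hs
  · apply Classified.of_graphH_succ
    refine isContained_graphH hV hD hs (fun v hv => notMem_hub hv) fun u v huv hu => ?_
    rcases hcases u v huv hu with h | h
    · have := Finset.card_pos.2 ⟨v, h⟩
      have := hsum2 u hu
      omega
    · exact h

end Main

/-! ### Classification with private neighbours, and the conclusion. -/

section Attached
variable {V : Type*} [Fintype V] {G : SimpleGraph V} {D : Finset V} {n d : ℕ}

theorem Core.classified_of_attached_eq_singleton (hC : Core G D) (hV : Fintype.card V = n)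
    (hd : 1 ≤ d) (hD : #D = d + 1) (h1 : ∀ b ∈ D, d ≤ G.degree b)
    (h2 : ∀ b ∈ D, G.degree b ≤ d + 1) {b : V} (hatt : attached G D = {b}) :
    Classified G n d := by
  obtain ⟨hb, p, hp⟩ := mem_attached.1 (hatt ▸ Finset.mem_singleton_self b)
  have huniq : ∀ x y z, x ∈ priv G D y → y ∈ D → z ∈ D → G.Adj x z → y = z :=
    fun x y z hx hy hz hxz =>
      hC.eq_of_mem_priv (fun c hc => by have := h1 c hc; omega) hx hy hz hxz
  have hpb := mem_priv.1 hp
  have hpriv : ∀ c ∈ D, c ≠ b → priv G D c = ∅ := by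
    intro c hc hcb
    by_contra hne
    have : c ∈ attached G D := mem_attached.2 ⟨hc, Finset.nonempty_iff_ne_empty.2 hne⟩
    rw [hatt] at this
    exact hcb (by simpa using this)
  -- The private neighbour `p` of `b` misses every other `c ∈ D`, so Ore's bound forces `deg c = d`.
  have hsum : ∀ c ∈ D, c ≠ b → #(inner G D c) + #(hub G D) = d := by
    intro c hc hcb
    have h3 := degree_eq_add (G := G) hc
    rw [hpriv c hc hcb, Finset.card_empty] at h3
    have h4 := hC.card_add_degree_le (T := {b}) hpb.1 (by simp [hb, hpb.2.2]) hc
      (fun h => hcb (huniq p b c hp hb hc h).symm)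
    rw [Finset.card_singleton] at h4
    have := h1 c hc
    omega
  have hbsum : #(inner G D b) + #(hub G D) ≤ d := by
    have h3 := degree_eq_add (G := G) hb
    have h4 := Finset.card_pos.2 ⟨p, hp⟩
    have := h2 b hb
    omega
  have hcases : ∀ u v, G.Adj u v → u ∈ D → u ≠ b → v ∈ inner G D u ∨ v ∈ hub G D := by
    intro u v huv hu hub
    have := adj_cases D huv
    rw [hpriv u hu hub] at this
    simpa using this
  have hB : #(D.erase b) = d := by
    rw [Finset.card_erase_of_mem hb]
    omega
  have hhub : ∀ v ∈ D.erase b, v ∉ hub G D := fun v hv => notMem_hub (Finset.mem_of_mem_erase hv)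
  rcases (show #(hub G D) = 0 ∨ #(hub G D) = d ∨
    (#(hub G D) = 1 ∧ #(inner G D b) = 0 ∧ #(hub G D) + 1 ≤ d) ∨
    (1 ≤ #(hub G D) ∧ 2 ≤ #(inner G D b) + #(hub G D) ∧ #(hub G D) + 2 ≤ d) ∨
    (2 ≤ #(inner G D b) + #(hub G D) ∧ #(hub G D) + 1 = d) by omega) with hs | hs | hs | hs | hs
  · apply Classified.of_graphK'
    rw [Finset.card_eq_zero] at hs
    refine isContained_graphK' hV (B := D.erase b) (c := b) hB (by simp) fun u v huv hu => ?_
    have := hcases u v huv (Finset.mem_of_mem_erase hu) (Finset.ne_of_mem_erase hu)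
    rw [hs, mem_inner] at this
    simp at this ⊢
    tauto
  · apply Classified.of_graphH
    refine isContained_graphH hV hB hs hhub fun u v huv hu => ?_
    have hu' := Finset.mem_of_mem_erase hu
    rcases hcases u v huv hu' (Finset.ne_of_mem_erase hu) with h | h
    · have := Finset.card_pos.2 ⟨v, h⟩
      have := hsum u hu' (Finset.ne_of_mem_erase hu)
      omega
    · exact h
  · apply Classified.of_graphK'
    obtain ⟨c, hc⟩ := Finset.card_eq_one.1 hs.1
    have hcD : c ∉ D := notMem_of_mem_hub (hc ▸ Finset.mem_singleton_self c : c ∈ hub G D)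
    refine isContained_graphK' hV hB (c := c) (fun h => hcD (Finset.mem_of_mem_erase h))
      fun u v huv hu => ?_
    have hu' := Finset.mem_of_mem_erase hu
    rcases hcases u v huv hu' (Finset.ne_of_mem_erase hu) with h | h
    · rw [mem_inner] at h
      refine Or.inl (Finset.mem_erase.2 ⟨?_, h.1⟩)
      rintro rfl
      have := Finset.card_pos.2 ⟨u, (mem_inner.2 ⟨hu', huv⟩ : u ∈ inner G D v)⟩
      omega
    · rw [hc] at h
      exact Or.inr (by simpa using h)
  · exfalso
    -- Here `b` may have small degree after contraction, but at least 3 thanks to its private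
    -- neighbour; it is the permitted exception.
    refine hC.false_of_coreDegree huniq (by omega) b
      (by rw [hatt, Finset.card_singleton]; omega) fun v hv => ?_
    unfold coreDegree
    by_cases hvb : v = b
    · right
      subst hvb
      rw [hatt, if_pos (Finset.mem_singleton_self v)]
      exact ⟨rfl, by omega⟩
    · left
      have := hsum v hv hvb
      omega
  · exfalso
    have hin : ∀ c ∈ D, #(inner G D c) ≤ 1 := by
      intro c hc
      by_cases hcb : c = b
      · subst hcb; omega
      · have := hsum c hc hcb; omega
    have hex : ∀ c ∈ D, 1 ≤ #(inner G D c) → ∃ e ∈ D, G.Adj c e := by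
      intro c hc h
      obtain ⟨e, he⟩ := Finset.card_pos.1 h
      rw [mem_inner] at he
      exact ⟨e, he.1, he.2.symm⟩
    have huq : ∀ b ∈ D, ∀ c ∈ D, ∀ e ∈ D, G.Adj b c → G.Adj b e → c = e := by
      intro b hb c hc e he hbc hbe
      exact eq_of_card_inner_le_one (hin b hb) hc hbc he hbe
    have hph : p ∉ hub G D := hpb.2.1
    have hpD : p ∉ D := hpb.1
    -- Now `D` induces a matching that covers all vertices except possibly `b`. Starting `X₂` at `p`
    -- saves one hub vertex, so two disjoint edges in `D` suffice for the excess of two.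
    rcases Nat.eq_zero_or_pos (#(inner G D b)) with h0 | h0
    · have hbn : ∀ c ∈ D, ¬ G.Adj c b := by
        intro c hc hcb
        have := Finset.card_pos.2 ⟨c, (mem_inner.2 ⟨hc, hcb⟩ : c ∈ inner G D b)⟩
        omega
      obtain ⟨c, hc, hcn⟩ := exists_ne_of_card_lt (S := D) [b] (by simp; omega)
      simp only [List.mem_cons, List.not_mem_nil, or_false] at hcn
      obtain ⟨e, he, hce⟩ := hex c hc (by have := hsum c hc hcn; omega)
      have heb : e ≠ b := by
        rintro rfl
        exact hbn c hc hce
      obtain ⟨f, hf, hfn⟩ := exists_ne_of_card_lt (S := D) [b, c, e] (by simp; omega)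
      simp only [List.mem_cons, List.not_mem_nil, or_false, not_or] at hfn
      obtain ⟨g, hg, hfg⟩ := hex f hf (by have := hsum f hf hfn.1; omega)
      have hgb : g ≠ b := by
        rintro rfl
        exact hbn f hf hfg
      have hgc : g ≠ c := by
        rintro rfl
        exact hfn.2.2 (huq g hg f hf e he hfg.symm hce)
      have hge : g ≠ e := by
        rintro rfl
        exact hfn.2.1 (huq g hg f hf c hc hfg.symm hce.symm)
      have h3 := hce.ne
      have h4 := hfg.ne
      have h5 : 5 ≤ #D := by
        have hnd : [b, c, e, f, g].Nodup := by
          simp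
          and_intros <;> grind
        have h6 : ([b, c, e, f, g] : List V).toFinset.card ≤ #D := by
          refine Finset.card_le_card fun x hx => ?_
          simp at hx
          rcases hx with rfl | rfl | rfl | rfl | rfl <;> assumption
        rw [List.toFinset_card_of_nodup hnd] at h6
        simpa using h6
      obtain ⟨q, r, t, hq, hr, ht, hqr, hqt, hrt⟩ :=
        Finset.two_lt_card_iff.1 (show 2 < #(hub G D) by omega)
      have hq' := notMem_of_mem_hub hq
      have hr' := notMem_of_mem_hub hr
      have ht' := notMem_of_mem_hub ht
      refine hC.false_of_weave (X₁ := [q, c, e, r]) (X₂ := [p, b, t, f, g]) ?_ ?_ ?_ rfl hq rfl hr'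
        rfl hpD rfl hg ?_
      · simp [hub_adj hq hc, hce, (hub_adj hr he).symm]
      · simp [hpb.2.2, (hub_adj ht hb).symm, hub_adj ht hf, hfg]
      · simp only [List.cons_append, List.nil_append, List.nodup_cons, List.mem_cons,
          List.not_mem_nil, or_false, not_or, not_false_eq_true, List.nodup_nil, and_true]
        and_intros <;> grind
      · simp [hq, hr, ht, hq', hr', ht', hph, hpD, hb, hc, he, hf, hg, notMem_hub]
        omega
    · obtain ⟨c, hc, hbc⟩ := hex b hb h0
      obtain ⟨e, he, hen⟩ := exists_ne_of_card_lt (S := D) [b, c] (by simp; omega)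
      simp only [List.mem_cons, List.not_mem_nil, or_false, not_or] at hen
      obtain ⟨f, hf, hef⟩ := hex e he (by have := hsum e he hen.1; omega)
      have hfb : f ≠ b := by
        rintro rfl
        exact hen.2 (huq f hf e he c hc hef.symm hbc)
      have hfc : f ≠ c := by
        rintro rfl
        exact hen.1 (huq f hf e he b hb hef.symm hbc.symm)
      have h3 := hbc.ne
      have h4 := hef.ne
      have h5 : 4 ≤ #D := by
        have hnd : [b, c, e, f].Nodup := by
          simp
          and_intros <;> grind
        have h6 : ([b, c, e, f] : List V).toFinset.card ≤ #D := by
          refine Finset.card_le_card fun x hx => ?_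
          simp at hx
          rcases hx with rfl | rfl | rfl | rfl <;> assumption
        rw [List.toFinset_card_of_nodup hnd] at h6
        simpa using h6
      obtain ⟨q, hq, r, hr, hqr⟩ := Finset.one_lt_card.1 (show 1 < #(hub G D) by omega)
      have hq' := notMem_of_mem_hub hq
      have hr' := notMem_of_mem_hub hr
      refine hC.false_of_weave (X₁ := [q, e, f, r]) (X₂ := [p, b, c]) ?_ ?_ ?_ rfl hq rfl hr'
        rfl hpD rfl hc ?_
      · simp [hub_adj hq he, hef, (hub_adj hr hf).symm]
      · simp [hpb.2.2, hbc]
      · simp only [List.cons_append, List.nil_append, List.nodup_cons, List.mem_cons,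
          List.not_mem_nil, or_false, not_or, not_false_eq_true, List.nodup_nil, and_true]
        and_intros <;> grind
      · simp [hq, hr, hq', hr', hph, hpD, hb, hc, he, hf, notMem_hub]
        omega

theorem Core.classified_of_one_lt_card_attached (hC : Core G D) (hV : Fintype.card V = n)
    (hd : 1 ≤ d) (hD : #D = d + 1) (h1 : ∀ b ∈ D, d ≤ G.degree b)
    (hatt : 1 < #(attached G D)) : Classified G n d := by
  have hdeg : ∀ c ∈ D, #D ≤ G.degree c + 1 := fun c hc => by have := h1 c hc; omega
  have huniq : ∀ x y z, x ∈ priv G D y → y ∈ D → z ∈ D → G.Adj x z → y = z :=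
    fun x y z hx hy hz hxz => hC.eq_of_mem_priv hdeg hx hy hz hxz
  have hother : ∀ c, ∃ b ∈ D, b ≠ c ∧ (priv G D b).Nonempty := by
    intro c
    obtain ⟨b, hb, hbc⟩ := Finset.exists_mem_ne hatt c
    exact ⟨b, (mem_attached.1 hb).1, hbc, (mem_attached.1 hb).2⟩
  have hpriv : ∀ c ∈ D, #(priv G D c) ≤ 1 := by
    intro c hc
    obtain ⟨b, hb, hbc, a, ha⟩ := hother c
    exact hC.card_priv_le_one hdeg ha hb hc hbc
  have hsum : ∀ c ∈ D, #(inner G D c) + #(hub G D) + #(priv G D c) = d := by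
    intro c hc
    obtain ⟨b, hb, hbc, a, ha⟩ := hother c
    have ha' := mem_priv.1 ha
    have h4 := hC.card_add_degree_le (T := {b}) ha'.1 (by simp [hb, ha'.2.2]) hc
      (fun h => hbc (huniq a b c ha hb hc h))
    rw [Finset.card_singleton] at h4
    have h3 := degree_eq_add (G := G) hc
    have := h1 c hc
    omega
  obtain ⟨b, hb, c, hc, hbc⟩ := Finset.one_lt_card.1 hatt
  obtain ⟨hb, p, hp⟩ := mem_attached.1 hb
  obtain ⟨hc, q, hq⟩ := mem_attached.1 hc
  have hpb := mem_priv.1 hp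
  have hqc := mem_priv.1 hq
  have hbs := hsum b hb
  have hbp := Finset.card_pos.2 ⟨p, hp⟩
  have hprivD : ∀ {a x}, a ∈ priv G D x → a ∉ D := fun h => (mem_priv.1 h).1
  have hprivH : ∀ {a x}, a ∈ priv G D x → a ∉ hub G D := fun h => (mem_priv.1 h).2.1
  have hprivA : ∀ {a x}, a ∈ priv G D x → G.Adj a x := fun h => (mem_priv.1 h).2.2
  have hprivne : ∀ {x y a e}, x ∈ D → y ∈ D → x ≠ y → a ∈ priv G D x → e ∈ priv G D y →
      a ≠ e := by
    rintro x y a e hx hy hxy ha he rfl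
    exact hxy (huniq a x y ha hx hy (hprivA he))
  -- Every vertex of `D` has degree exactly `d` and at most one private neighbour, so contraction
  -- preserves its degree; this settles hubs of at most `d - 2` vertices. For a hub of size `d - 1`,
  -- each vertex of `D` has exactly one further neighbour, in `D` or private.
  rcases (show #(hub G D) + 2 ≤ d ∨ #(hub G D) + 1 = d by omega) with hs | hs
  · exfalso
    refine hC.false_of_coreDegree huniq (by omega) b (by omega) fun v hv => Or.inl ?_
    have h3 := hsum v hv
    have h4 := hpriv v hv
    unfold coreDegree
    split_ifs with h5
    · omega
    · rw [mem_attached] at h5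
      have : priv G D v = ∅ := by
        rw [← Finset.not_nonempty_iff_eq_empty]
        exact fun h => h5 ⟨hv, h⟩
      rw [this, Finset.card_empty] at h3
      omega
  rcases hd.eq_or_lt with hd1 | hd2
  · apply Classified.of_graphH
    have hpb1 := hpriv b hb
    refine isContained_graphH hV (B := {b}) (S := priv G D b) (by rw [Finset.card_singleton, hd1])
      (by omega) ?_ fun u v huv hu => ?_
    · intro v hv hv2
      rw [Finset.mem_singleton] at hv
      exact hprivD hv2 (hv ▸ hb)
    · rw [Finset.mem_singleton] at hu
      subst hu
      rcases adj_cases D huv with h | h | h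
      · have := Finset.card_pos.2 ⟨v, h⟩
        omega
      · have := Finset.card_pos.2 ⟨v, h⟩
        omega
      · exact h
  by_cases hedge : ∃ e ∈ D, ∃ f ∈ D, G.Adj e f
  · exfalso
    obtain ⟨e, he, f, hf, hef⟩ := hedge
    have hno : ∀ x ∈ D, ∀ y ∈ D, ∀ z ∈ D, G.Adj x y → (priv G D z).Nonempty → z ≠ x := by
      rintro x hx y hy z hz hxy h3 rfl
      have h4 := Finset.card_pos.2 h3
      have h5 := Finset.card_pos.2 ⟨y, (mem_inner.2 ⟨hy, hxy.symm⟩ : y ∈ inner G D z)⟩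
      have h6 := hsum z hz
      omega
    have hbe := hno e he f hf b hb hef ⟨p, hp⟩
    have hbf := hno f hf e he b hb hef.symm ⟨p, hp⟩
    have hce := hno e he f hf c hc hef ⟨q, hq⟩
    have hcf := hno f hf e he c hc hef.symm ⟨q, hq⟩
    have hpq := hprivne hb hc hbc hp hq
    have h3 := hef.ne
    have h5 : 4 ≤ #D := by
      have hnd : [b, c, e, f].Nodup := by
        simp
        and_intros <;> grind
      have h6 : ([b, c, e, f] : List V).toFinset.card ≤ #D := by
        refine Finset.card_le_card fun x hx => ?_
        simp at hx
        rcases hx with rfl | rfl | rfl | rfl <;> assumption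
      rw [List.toFinset_card_of_nodup hnd] at h6
      simpa using h6
    obtain ⟨r, hr, t, ht, hrt⟩ := Finset.one_lt_card.1 (show 1 < #(hub G D) by omega)
    have hr' := notMem_of_mem_hub hr
    have ht' := notMem_of_mem_hub ht
    have hp' := hprivD hp
    have hp'' := hprivH hp
    have hq' := hprivD hq
    have hq'' := hprivH hq
    -- The private ends `p`, `q` and the single edge `ef` give four vertices of `D` against two hub
    -- vertices.
    refine hC.false_of_weave (X₁ := [r, c, q]) (X₂ := [p, b, t, e, f]) ?_ ?_ ?_ rfl hr rfl hq'
      rfl hp' rfl hf ?_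
    · simp [hub_adj hr hc, (hprivA hq).symm]
    · simp [hprivA hp, (hub_adj ht hb).symm, hub_adj ht he, hef]
    · simp only [List.cons_append, List.nil_append, List.nodup_cons, List.mem_cons,
        List.not_mem_nil, or_false, not_or, not_false_eq_true, List.nodup_nil, and_true]
      and_intros <;> grind
    · simp [hr, ht, hr', ht', hp', hp'', hq', hq'', hb, hc, he, hf, notMem_hub]
      omega
  have hin : ∀ x ∈ D, inner G D x = ∅ := by
    intro x hx
    rw [Finset.eq_empty_iff_forall_notMem]
    intro y hy
    rw [mem_inner] at hy
    exact hedge ⟨y, hy.1, x, hx, hy.2⟩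
  have hone : ∀ x ∈ D, ∃ a, priv G D x = {a} := by
    intro x hx
    have := hsum x hx
    rw [hin x hx, Finset.card_empty] at this
    exact Finset.card_eq_one.1 (by omega)
  obtain ⟨e, he, hen⟩ := exists_ne_of_card_lt (S := D) [b, c] (by simp; omega)
  simp only [List.mem_cons, List.not_mem_nil, or_false, not_or] at hen
  obtain ⟨r, hr⟩ := hone e he
  have hr : r ∈ priv G D e := hr ▸ Finset.mem_singleton_self r
  have hpq := hprivne hb hc hbc hp hq
  have hrp := hprivne he hb hen.1 hr hp
  have hrq := hprivne he hc hen.2 hr hq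
  have hpD := hprivD hp
  have hpH := hprivH hp
  have hqD := hprivD hq
  have hqH := hprivH hq
  have hrD := hprivD hr
  have hrH := hprivH hr
  rcases (show 2 ≤ d from hd2).eq_or_lt with hd2 | hd3
  · subst hd2
    refine Or.inl ⟨rfl, ?_⟩
    obtain ⟨x, hx⟩ := Finset.card_eq_one.1 (show #(hub G D) = 1 by omega)
    have hxh : x ∈ hub G D := hx ▸ Finset.mem_singleton_self x
    have hxD := notMem_of_mem_hub hxh
    have key : ∀ u ∈ D, ∀ a ∈ priv G D u, ∀ v, G.Adj u v → v = x ∨ v = a := by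
      intro u hu a ha v huv
      rcases adj_cases D huv with h | h | h
      · rw [hin u hu] at h
        simp at h
      · rw [hx] at h
        exact Or.inl (by simpa using h)
      · exact Or.inr (Finset.card_le_one.1 (hpriv u hu) v h a ha)
    refine isContained_graphG' hV (b := b) (c := c) (e := e) (x := x) (p := p) (q := q) (r := r) ?_
      (key b hb p hp) (key c hc q hq) (key e he r hr)
    simp only [List.nodup_cons, List.mem_cons,
      List.not_mem_nil, or_false, not_or, not_false_eq_true, List.nodup_nil, and_true]
    and_intros <;> grind
  · exfalso
    obtain ⟨f, hf, hfn⟩ := exists_ne_of_card_lt (S := D) [b, c, e] (by simp; omega)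
    simp only [List.mem_cons, List.not_mem_nil, or_false, not_or] at hfn
    obtain ⟨t, ht⟩ := hone f hf
    have ht : t ∈ priv G D f := ht ▸ Finset.mem_singleton_self t
    have htp := hprivne hf hb hfn.1 ht hp
    have htq := hprivne hf hc hfn.2.1 ht hq
    have htr := hprivne hf he hfn.2.2 ht hr
    have htD := hprivD ht
    have htH := hprivH ht
    obtain ⟨x, hx, y, hy, hxy⟩ := Finset.one_lt_card.1 (show 1 < #(hub G D) by omega)
    have hx' := notMem_of_mem_hub hx
    have hy' := notMem_of_mem_hub hy
    -- With no edge inside `D`, four private neighbours are used instead; the clique edge `qr` joins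
    -- two of them.
    refine hC.false_of_weave (X₁ := [x, c, q, r, e, y, f, t]) (X₂ := [p, b]) ?_ ?_ ?_ rfl hx rfl htD
      rfl hpD rfl hb ?_
    · simp [hub_adj hx hc, (hprivA hq).symm, hC.adj q r hqD hrD hrq.symm, hprivA hr,
        (hub_adj hy he).symm, hub_adj hy hf, (hprivA ht).symm]
    · simp [hprivA hp]
    · simp only [List.cons_append, List.nil_append, List.nodup_cons, List.mem_cons,
        List.not_mem_nil, or_false, not_or, not_false_eq_true, List.nodup_nil, and_true]
      and_intros <;> grind
    · simp [hx, hy, hx', hy', hpD, hpH, hqD, hqH, hrD, hrH, htD, htH, hb, hc, he, hf, notMem_hub]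
      omega

theorem Core.classified (hC : Core G D) (hV : Fintype.card V = n) (hd : 1 ≤ d)
    (hD : #D = d ∨ #D = d + 1) (h1 : ∀ b ∈ D, d ≤ G.degree b) (h2 : ∀ b ∈ D, G.degree b ≤ #D) :
    Classified G n d := by
  rcases hD with hD | hD
  · rcases hC.isContained_of_card_eq hV hd hD
      (fun b hb => le_antisymm (hD ▸ h2 b hb) (h1 b hb)) with h | h
    · exact Classified.of_graphH h
    · exact Classified.of_graphK' h
  · rw [hD] at h2
    rcases (show #(attached G D) = 0 ∨ #(attached G D) = 1 ∨ 1 < #(attached G D) by omega) with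
      h | h | h
    · exact hC.classified_of_attached_eq_empty hV hd hD h1 h2 (Finset.card_eq_zero.1 h)
    · obtain ⟨b, hb⟩ := Finset.card_eq_one.1 h
      exact hC.classified_of_attached_eq_singleton hV hd hD h1 h2 hb
    · exact hC.classified_of_one_lt_card_attached hV hd hD h1 h

theorem Sat.classified (hG : Sat G) (hn : 3 ≤ n) (hV : Fintype.card V = n) (hd : 1 ≤ d)
    (hdeg : ∀ v, d ≤ G.degree v) {k : ℕ} (hk2 : 2 ≤ k)
    (hcl : max (hk k n (d + 2)) (hk k n ((n - 1) / 2)) < #(G.cliqueFinset k)) :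
    Classified G n d := by
  obtain ⟨D, h1, h2, h3, h4⟩ :=
    hG.exists_lowDegree_set hn hV ((le_max_right _ _).trans_lt hcl)
  have hdD : d ≤ #D := by
    obtain ⟨v, hv⟩ := Finset.card_pos.1 h1
    exact (hdeg v).trans (h3 v hv)
  have hDd : #D ≤ d + 1 := by
    by_contra hc
    have h5 := card_cliqueFinset_le G (k := k) D rfl h3
    rw [hV] at h5
    -- If `#D ≥ d + 2`, then `#D` lies between `d + 2` and `(n - 1) / 2`, and convexity contradicts
    -- the clique hypothesis.
    have h6 := hk_le_max (n := n) hk2 (show d + 2 ≤ #D by omega) h2.le (by omega)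
    omega
  exact Core.classified ⟨hG, h4, by omega⟩ hV hd (by omega) (fun b _ => hdeg b) h3

end Attached
end NonhamStability

theorem theorem2p5 {V : Type*} [Fintype V] [DecidableEq V]
    (G : SimpleGraph V) [DecidableRel G.Adj] (n d : ℕ)
    (hn : 3 ≤ n) (hd1 : 1 ≤ d) (hd2 : d ≤ (n - 1) / 2)
    (hcard : Fintype.card V = n)
    (hham : ¬ G.IsHamiltonian)
    (hdeg : d ≤ G.minDegree)
    (hcliques : ∃ k : ℕ, 2 ≤ k ∧
      max (NonhamStability.hk k n (d + 2)) (NonhamStability.hk k n ((n - 1) / 2))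
        < (G.cliqueFinset k).card) :
    (d = 2 → G.IsContained (NonhamStability.graphG' n) ∨
      ∃ H ∈ NonhamStability.family n 2, G.IsContained H) ∧
    (d = 3 → G.IsContained (NonhamStability.graphF n) ∨
      ∃ H ∈ NonhamStability.family n 3, G.IsContained H) ∧
    ((d = 1 ∨ 4 ≤ d) → ∃ H ∈ NonhamStability.family n d, G.IsContained H) := by
  classical
  obtain ⟨k, hk2, hcl⟩ := hcliques
  obtain ⟨H, hGH, hH⟩ := NonhamStability.exists_sat
    (fun h : NonhamStability.Ham G => hham (h.isHamiltonian (by omega)))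
  have hdegH : ∀ v, d ≤ H.degree v := fun v =>
    hdeg.trans ((G.minDegree_le_degree v).trans (SimpleGraph.degree_le_of_le hGH))
  have hclH : (G.cliqueFinset k).card ≤ (H.cliqueFinset k).card :=
    Finset.card_le_card (SimpleGraph.cliqueFinset_mono _ hGH)
  have hmain : NonhamStability.Classified H n d := by
    refine hH.classified hn hcard hd1 (fun v => ?_) hk2
      ((hcl.trans_le hclH).trans_eq ?_)
    · convert hdegH v
    · congr!
  rcases hmain.mono hGH with ⟨rfl, h⟩ | ⟨rfl, h⟩ | h
  · exact ⟨fun _ => Or.inl h, by omega, by omega⟩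
  · exact ⟨by omega, fun _ => Or.inl h, by omega⟩
  · refine ⟨?_, ?_, fun _ => h⟩
    · rintro rfl
      exact Or.inr h
    · rintro rfl
      exact Or.inr h
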